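/- Let $H$ be a complex Hilbert space with inner product $\langle\cdot,\cdot\rangle$ (anti-linear on the left, linear on the right), and let $x\mapsto\bar x$ be a self-adjoint involution on $H$, i.e. a complex-linear map with $\langle \bar x,y\rangle=\langle x,\bar y\rangle$ and $\bar{\bar x}=x$. Let $\alpha,q\in(-1,1)$. Let $\Sigma(n)$ be the group of bijections $\sigma$ of $\{\pm1,\dots,\pm n\}$ with $\sigma(-k)=-\sigma(k)$, generated by $\pi_0=(1,-1)$ and $\pi_i=(i,i+1)$, $1\le i\le n-1$ (exchanging also $-i$ and $-(i+1)$). It acts on the algebraic tensor power $H^{\otimes n}$: $\pi_0$ replaces the first factor $x_1$ by $\overline{x_1}$, and $\pi_i$ exchanges the $i$-th and $(i+1)$-st factors. For $\sigma\in\Sigma(n)$ let $l_1(\sigma)$ be the number of $\pi_0$'s and $l_2(\sigma)$ the number of $\pi_i$'s with $i\ge1$ in a word of minimal length in the generators representing $\sigma$ (they do not depend on the word). On the algebraic full Fock space $\mathcal F(H)=\bigoplus_{n\ge0}H^{\otimes n}$ (finite sums, $H^{\otimes0}=\mathbb C\Omega$) let $\langle\cdot,\cdot\rangle_{0,0}$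 be the inner product with $\langle x_1\otimes\cdots\otimes x_m,y_1\otimes\cdots\otimes y_n\rangle_{0,0}=\delta_{m,n}\prod_{i=1}^n\langle x_i,y_i\rangle$, and let $$P_{\alpha,q}=\bigoplus_{n\ge0}P^{(n)}_{\alpha,q},\qquad P^{(n)}_{\alpha,q}=\sum_{\sigma\in\Sigma(n)}\alpha^{l_1(\sigma)}q^{l_2(\sigma)}\,\sigma\quad(0^0=1),\qquad \langle f,g\rangle_{\alpha,q}=\langle f,P_{\alpha,q}\,g\rangle_{0,0}.$$ For $x\in H$ let $b^*(x)$ be the creation operator on $\mathcal F(H)$: $b^*(x)(x_1\otimes\cdots\otimes x_n)=x_1\otimes\cdots\otimes x_n\otimes x$, $b^*(x)\Omega=x$. **Theorem.** The form $\langle\cdot,\cdot\rangle_{\alpha,q}$ is an inner product on $\mathcal F(H)$. Let $x\in H$, $x\ne0$ (the number $\langle x,\bar x\rangle$ is real). Then $b^*(x)$ is bounded for the norm $\|f\|_{\alpha,q}=\sqrt{\langle f,f\rangle_{\alpha,q}}$, and its operator norm $\|b^*(x)\|_{\alpha,q}$ satisfies: 1. If $-1<q\le0$ and $\alpha\langle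 x,\bar x\rangle\ge0$, then $\|b^*(x)\|_{\alpha,q}=\sqrt{\|x\|^2+\alpha\langle x,\bar x\rangle}$. 2. If $-1<q\le0$ and $\alpha\langle x,\bar x\rangle<0$, then $\dfrac{\|x\|}{\sqrt{1-q}}\le\|b^*(x)\|_{\alpha,q}\le\|x\|$. 3. If $|\alpha|\le q<1$, then $\|b^*(x)\|_{\alpha,q}=\dfrac{\|x\|}{\sqrt{1-q}}$. 4. If $0<q<\alpha\langle x,\bar x\rangle/\|x\|^2$, then $\dfrac{\|x\|}{\sqrt{1-q}}<\|b^*(x)\|_{\alpha,q}\le\sqrt{\dfrac{1+|\alpha|}{1-q}}\,\|x\|$. 5. In all other cases, $\dfrac{\|x\|}{\sqrt{1-q}}\le\|b^*(x)\|_{\alpha,q}\le\sqrt{\dfrac{1+|\alpha|}{1-q}}\,\|x\|$. -/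

import Mathlib

open scoped TensorProduct DirectSum ComplexConjugate

namespace TypeB

/-! ### The hyperoctahedral group -/

/-- `Σ(n)`: the group of bijections `σ` of the `2n` points `±1, …, ±n` with `σ(-k) = -σ(k)`.
The point `s·(i+1)` (for `i = 0, …, n-1` and a sign `s = ±1`) is encoded as the pair `(i, s)`. -/
def hyperoctahedral (n : ℕ) : Subgroup (Equiv.Perm (Fin n × ℤˣ)) where
  carrier := {σ | ∀ i s, σ (i, -s) = ((σ (i, s)).1, -(σ (i, s)).2)}
  one_mem' := fun _ _ => rfl
  mul_mem' := by
    intro σ τ hσ hτ i s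
    rw [Equiv.Perm.mul_apply, hτ, hσ]
    rfl
  inv_mem' := by
    intro σ hσ i s
    rw [Equiv.Perm.inv_eq_iff_eq, hσ]
    simp

noncomputable instance (n : ℕ) : Fintype (hyperoctahedral n) := Fintype.ofFinite _

/-- The Coxeter generators `π_0 = (1, -1)` and `π_i = (i, i+1)` (which also exchanges `-i` and
`-(i+1)`) for `1 ≤ i ≤ n - 1`. -/
def generator {n : ℕ} (i : Fin n) : hyperoctahedral n :=
  if i.val = 0 then
    ⟨Equiv.swap (i, 1) (i, -1), by
      intro j s
      by_cases hj : j = i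
      · subst hj
        rcases Int.units_eq_one_or s with rfl | rfl <;> simp
      · rw [Equiv.swap_apply_of_ne_of_ne, Equiv.swap_apply_of_ne_of_ne] <;> simp [hj]⟩
  else
    ⟨(Equiv.swap (⟨i.val - 1, by omega⟩ : Fin n) i).prodCongr (Equiv.refl ℤˣ), fun _ _ => rfl⟩

/-- The product `π_{i_1} ⋯ π_{i_k}` of a word in the generators. -/
def wordProd {n : ℕ} (w : List (Fin n)) : hyperoctahedral n := (w.map generator).prod

/-- `w` is an irreducible form of `σ`: a word of minimal length with product `σ`. -/
def IsReducedWord {n : ℕ} (σ : hyperoctahedral n) (w : List (Fin n)) : Prop :=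
  wordProd w = σ ∧ ∀ w', wordProd w' = σ → w.length ≤ w'.length

/-- `l₁(σ)`: the number of occurrences of `π_0` in an irreducible form of `σ`
(all irreducible forms have the same number of them). -/
noncomputable def l₁ {n : ℕ} (σ : hyperoctahedral n) : ℕ :=
  sInf {k | ∃ w, IsReducedWord σ w ∧ k = w.countP (fun i => i.val = 0)}

/-- `l₂(σ)`: the number of occurrences of `π_1, …, π_{n-1}` in an irreducible form of `σ`
(all irreducible forms have the same number of them). -/
noncomputable def l₂ {n : ℕ} (σ : hyperoctahedral n) : ℕ :=
  sInf {k | ∃ w, IsReducedWord σ w ∧ k = w.countP (fun i => i.val ≠ 0)}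

theorem fst_apply {n : ℕ} (σ : hyperoctahedral n) (p : Fin n × ℤˣ) :
    (σ.1 (p.1, 1)).1 = (σ.1 p).1 := by
  obtain ⟨i, s⟩ := p
  rcases Int.units_eq_one_or s with rfl | rfl
  · rfl
  · rw [σ.2 i 1]

/-- The permutation `j ↦ |σ(j)|` of the positions underlying `σ`. -/
def absPerm {n : ℕ} (σ : hyperoctahedral n) : Equiv.Perm (Fin n) where
  toFun i := (σ.1 (i, 1)).1
  invFun i := (σ⁻¹.1 (i, 1)).1
  left_inv i := by
    change (σ⁻¹.1 ((σ.1 (i, 1)).1, 1)).1 = i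
    rw [fst_apply]
    simp
  right_inv i := by
    change (σ.1 ((σ⁻¹.1 (i, 1)).1, 1)).1 = i
    rw [fst_apply]
    simp

/-! ### The algebraic full Fock space and its free inner product -/

section Fock

variable {H : Type*} [NormedAddCommGroup H] [InnerProductSpace ℂ H]

/-- The linear functional `y_1 ⊗ ⋯ ⊗ y_n ↦ ∏ ⟨x_i, y_i⟩` on the algebraic tensor power. -/
noncomputable def prodInner {n : ℕ} (x : Fin n → H) : (⨂[ℂ]^n H) →ₗ[ℂ] ℂ :=
  PiTensorProduct.lift
    ((MultilinearMap.mkPiAlgebra ℂ (Fin n) ℂ).compLinearMap fun i => innerₛₗ ℂ (x i))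

theorem prodInner_tprod {n : ℕ} (x y : Fin n → H) :
    prodInner x (PiTensorProduct.tprod ℂ y) = ∏ i, inner ℂ (x i) (y i) := by
  simp [prodInner]

theorem prodInner_tprod_conj {n : ℕ} (x y : Fin n → H) :
    prodInner x (PiTensorProduct.tprod ℂ y) = conj (prodInner y (PiTensorProduct.tprod ℂ x)) := by
  simp [prodInner_tprod]

/-- The inner product on `H^{⊗n}` (anti-linear on the left, linear on the right), determined by
`⟨x_1 ⊗ ⋯ ⊗ x_n, y_1 ⊗ ⋯ ⊗ y_n⟩_{0,0} = ∏ ⟨x_i, y_i⟩`. -/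
noncomputable def tensorInner (n : ℕ) : (⨂[ℂ]^n H) →ₗ⋆[ℂ] (⨂[ℂ]^n H) →ₗ[ℂ] ℂ :=
  let A : (⨂[ℂ]^n H) →+ ((⨂[ℂ]^n H) →ₗ[ℂ] ℂ) :=
    PiTensorProduct.liftAddHom (fun p => conj p.1 • prodInner p.2)
      (fun r f i hf => by
        apply PiTensorProduct.ext; ext y
        simp [prodInner_tprod_conj f, (PiTensorProduct.tprod ℂ).map_coord_zero i hf])
      (fun f => by simp)
      (fun r f i m₁ m₂ => by
        apply PiTensorProduct.ext; ext y
        simp [prodInner_tprod_conj _ y, mul_add])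
      (fun r r' f => by simp [add_smul])
      (fun r f i r' => by
        apply PiTensorProduct.ext; ext y
        simp [prodInner_tprod_conj _ y]
        ring)
  { A with
    map_smul' := by
      intro c u
      change A (c • u) = conj c • A u
      induction u using PiTensorProduct.induction_on with
      | smul_tprod r f =>
        have hA : ∀ z : ℂ, A (z • PiTensorProduct.tprod ℂ f) = conj z • prodInner f := by
          intro z
          rw [← PiTensorProduct.tprodCoeff_eq_smul_tprod]
          rfl
        rw [smul_smul, hA, hA, smul_smul, map_mul]
      | add u v hu hv => rw [smul_add, map_add, hu, hv, map_add, smul_add] }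

theorem tensorInner_tprod {n : ℕ} (x y : Fin n → H) :
    tensorInner n (PiTensorProduct.tprod ℂ x) (PiTensorProduct.tprod ℂ y)
      = ∏ i, inner ℂ (x i) (y i) := by
  rw [← prodInner_tprod, PiTensorProduct.tprod_eq_tprodCoeff_one]
  change (conj (1 : ℂ) • prodInner x) _ = _
  simp

variable (H) in
/-- The algebraic full Fock space `⨁_{n ≥ 0} H^{⊗n}` (algebraic tensor powers, finite sums);
the vacuum `Ω` is the empty tensor in degree `0`. -/
abbrev FockSpace : Type _ := ⨁ n : ℕ, ⨂[ℂ]^n H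

/-- The free inner product `⟨·, ·⟩_{0,0}`: the orthogonal direct sum of the inner products of the
`H^{⊗n}`. -/
noncomputable def freeInner (f g : FockSpace H) : ℂ :=
  open Classical in DFinsupp.sum f fun n u => tensorInner n u (g n)

/-! ### The deformed inner product -/

/-- The action of `σ ∈ Σ(n)` on `H^{⊗n}` defined by the involution `J`: with `x_{-k} := J x_k`, it
sends `x_1 ⊗ ⋯ ⊗ x_n` to `x_{σ⁻¹(1)} ⊗ ⋯ ⊗ x_{σ⁻¹(n)}`. (First apply `J` to those `x_j` for which
`σ(j)` is negative, then move the `j`-th factor to position `|σ(j)|`.) -/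
noncomputable def action (J : H →ₗ[ℂ] H) {n : ℕ} (σ : hyperoctahedral n) :
    (⨂[ℂ]^n H) →ₗ[ℂ] (⨂[ℂ]^n H) :=
  (PiTensorProduct.reindex ℂ (fun _ => H) (absPerm σ)).toLinearMap ∘ₗ
    PiTensorProduct.map fun j => if (σ.1 (j, 1)).2 = 1 then LinearMap.id else J

/-- The type B symmetrization operator
`P_{α,q}^{(n)} = ∑_{σ ∈ Σ(n)} α^{l₁(σ)} q^{l₂(σ)} σ` on `H^{⊗n}`. -/
noncomputable def symmetrization (J : H →ₗ[ℂ] H) (α q : ℝ) (n : ℕ) :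
    (⨂[ℂ]^n H) →ₗ[ℂ] (⨂[ℂ]^n H) :=
  ∑ σ : hyperoctahedral n, ((α ^ l₁ σ * q ^ l₂ σ : ℝ) : ℂ) • action J σ

/-- `P_{α,q} = ⨁_n P_{α,q}^{(n)}` on the algebraic full Fock space. -/
noncomputable def fockSymmetrization (J : H →ₗ[ℂ] H) (α q : ℝ) : FockSpace H →ₗ[ℂ] FockSpace H :=
  DirectSum.lmap fun n => symmetrization J α q n

/-- The deformed inner product `⟨f, g⟩_{α,q} = ⟨f, P_{α,q} g⟩_{0,0}`. -/
noncomputable def deformedInner (J : H →ₗ[ℂ] H) (α q : ℝ) (f g : FockSpace H) : ℂ :=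
  freeInner f (fockSymmetrization J α q g)

/-- The norm `‖f‖_{α,q} = √⟨f, f⟩_{α,q}`. -/
noncomputable def fockNorm (J : H →ₗ[ℂ] H) (α q : ℝ) (f : FockSpace H) : ℝ :=
  Real.sqrt (deformedInner J α q f f).re

/-! ### Creation operators and operator norms -/

/-- The creation operator `b*(x)`: the linear map
`x_1 ⊗ ⋯ ⊗ x_n ↦ x_1 ⊗ ⋯ ⊗ x_n ⊗ x` (in particular `Ω ↦ x`). -/
noncomputable def creation (x : H) : FockSpace H →ₗ[ℂ] FockSpace H :=
  DirectSum.toModule ℂ ℕ (FockSpace H) fun n =>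
    DirectSum.lof ℂ ℕ (fun m => ⨂[ℂ]^m H) (n + 1) ∘ₗ
      PiTensorProduct.lift ((LinearMap.applyₗ x).compMultilinearMap
        (PiTensorProduct.tprod ℂ : MultilinearMap ℂ (fun _ : Fin (n + 1) => H) _).curryRight)

/-- `T` is bounded for the norm `‖·‖_{α,q}`. -/
def IsBoundedOp (J : H →ₗ[ℂ] H) (α q : ℝ) (T : FockSpace H →ₗ[ℂ] FockSpace H) : Prop :=
  ∃ c : ℝ, ∀ f, fockNorm J α q (T f) ≤ c * fockNorm J α q f

/-- The operator norm `‖T‖_{α,q}` of a bounded operator `T` on the Fock space with the norm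
`‖·‖_{α,q}`: the least `c ≥ 0` with `‖T f‖_{α,q} ≤ c ‖f‖_{α,q}` for all `f`. -/
noncomputable def opNorm (J : H →ₗ[ℂ] H) (α q : ℝ) (T : FockSpace H →ₗ[ℂ] FockSpace H) : ℝ :=
  sInf {c : ℝ | 0 ≤ c ∧ ∀ f, fockNorm J α q (T f) ≤ c * fockNorm J α q f}

end Fock

end TypeB

namespace TypeB

/-! ### Roots and separating walls -/

/-! Positivity is Coxeter geometry. The elements of `Σ(n)` label the chambers of the type B
arrangement, and right multiplication by a generator crosses one wall, attached to a short root
exactly when the generator is `π_0`. A shortest gallery crosses each separating hyperplane once, so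
`l₁` and `l₂` of `σ⁻¹ τ` count the short and long roots separating `σ` from `τ` (`l₁_inv_mul`,
`l₂_inv_mul`). Hence the kernel `α^{l₁(σ⁻¹τ)} q^{l₂(σ⁻¹τ)}` is a product over roots of two-valued
kernels with off-diagonal parameter in `(-1, 1)`. Each factor is positive semidefinite, and because
the roots distinguish the chambers, the product dominates a positive multiple of the identity
(`kernelForm_agreeKernel_univ_ge`). Averaging the form over an orbit of the unitary group action
gives `symmetrization_pos`.

For the norm, `Σ(n + 1)` is factored as `Σ(n)` times minimal coset representatives, with
multiplicative weight (`weight_extend_mul`). This makes the adjoint `b(x)` of `b*(x)` explicit and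
yields `b(x) b*(y) = q b*(y) b(x) + ⟨x, y⟩ + α ⟨x, J y⟩ q^{2N}`. With `β = ⟨x, J x⟩`, in degree `n ≥
1`, `‖b*(x) f‖² = (‖x‖² + α β q^{2n}) ‖f‖² + q ‖b(x) f‖²`. If `q ≤ 0` the last term is dropped. If
`q ≥ 0`, the bound of `b(x)` in degree `n` is that of `b*(x)` in degree `n - 1`, and the resulting
recursion has the closed solution `‖x‖² (1 - q^{n+1}) (1 + |α| q^n) / (1 - q)`
(`tensorForm_creation_le_of_nonneg`).

Lower bounds come from the vectors `x^{⊗n}`, where the ratio of squared norms is exactly `(1 -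
q^{n+1}) / (1 - q) * (‖x‖² + α β q^n)`. Degree `0` gives the value in case 1, the limit gives `‖x‖²
/ (1 - q)`, and in case 4 a large finite `n` exceeds this limit. -/

/-- The signed integer `s (i + 1)` encoded by the pair `(i, s)`. -/
def signedVal {n : ℕ} (p : Fin n × ℤˣ) : ℤ := p.2 * (p.1.val + 1)

@[simp] theorem signedVal_one {n : ℕ} (i : Fin n) : signedVal (i, 1) = i.val + 1 := by
  simp [signedVal]

@[simp] theorem signedVal_neg {n : ℕ} (i : Fin n) (s : ℤˣ) :
    signedVal (i, -s) = -signedVal (i, s) := by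
  simp [signedVal]

theorem signedVal_injective {n : ℕ} : Function.Injective (signedVal (n := n)) := by
  rintro ⟨i, s⟩ ⟨j, t⟩ h
  rcases Int.units_eq_one_or s with rfl | rfl <;> rcases Int.units_eq_one_or t with rfl | rfl <;>
    simp [Fin.ext_iff] at h ⊢ <;> omega

/-- The point `-p`. -/
def opp {n : ℕ} (p : Fin n × ℤˣ) : Fin n × ℤˣ := (p.1, -p.2)

@[simp] theorem signedVal_opp {n : ℕ} (p : Fin n × ℤˣ) : signedVal (opp p) = -signedVal p :=
  signedVal_neg p.1 p.2

theorem apply_opp {n : ℕ} (σ : hyperoctahedral n) (p : Fin n × ℤˣ) :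
    σ.1 (opp p) = opp (σ.1 p) := σ.2 p.1 p.2

theorem fst_eq_iff {n : ℕ} (p r : Fin n × ℤˣ) :
    p.1 = r.1 ↔ signedVal p = signedVal r ∨ signedVal p = -signedVal r := by
  obtain ⟨i, s⟩ := p
  obtain ⟨j, t⟩ := r
  rcases Int.units_eq_one_or s with rfl | rfl <;> rcases Int.units_eq_one_or t with rfl | rfl <;>
    simp [Fin.ext_iff] <;> omega

/-- A positive root of type B: a pair of points `p < p'` with `p + p' ≥ 0`. -/
abbrev Root (n : ℕ) : Type :=
  {t : (Fin n × ℤˣ) × (Fin n × ℤˣ) //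
    signedVal t.1 < signedVal t.2 ∧ 0 ≤ signedVal t.1 + signedVal t.2}

/-- The order that `σ⁻¹` induces on a pair of points. -/
def Below {n : ℕ} (σ : hyperoctahedral n) (a b : Fin n × ℤˣ) : Prop :=
  signedVal (σ⁻¹.1 a) < signedVal (σ⁻¹.1 b)

/-- The hyperplane of the root `t` separates the chambers of `σ` and `τ`. -/
def Separates {n : ℕ} (σ τ : hyperoctahedral n) (t : Root n) : Prop :=
  ¬ (Below σ t.1.1 t.1.2 ↔ Below τ t.1.1 t.1.2)

theorem below_opp {n : ℕ} (σ : hyperoctahedral n) (a b : Fin n × ℤˣ) :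
    Below σ (opp a) (opp b) ↔ Below σ b a := by
  simp only [Below, apply_opp, signedVal_opp, neg_lt_neg_iff]

theorem not_below {n : ℕ} (σ : hyperoctahedral n) {a b : Fin n × ℤˣ} (h : a ≠ b) :
    ¬ Below σ a b ↔ Below σ b a := by
  have : signedVal (σ⁻¹.1 a) ≠ signedVal (σ⁻¹.1 b) := fun h' =>
    h ((σ⁻¹.1).injective (signedVal_injective h'))
  simp only [Below]
  omega

/-- Every pair of distinct points represents exactly one positive root. -/
theorem exists_root {n : ℕ} {a b : Fin n × ℤˣ} (h : a ≠ b) :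
    ∃ t : Root n, (t.1.1.1 = t.1.2.1 ↔ a.1 = b.1) ∧
      (∀ σ τ, Separates σ τ t ↔ ¬ (Below σ a b ↔ Below τ a b)) ∧
      ∀ t' : Root n, (t' = t ↔ t'.1 = (a, b) ∨ t'.1 = (b, a) ∨ t'.1 = (opp a, opp b) ∨
        t'.1 = (opp b, opp a)) := by
  have hv : signedVal a ≠ signedVal b := fun h' => h (signedVal_injective h')
  have hsw : ∀ σ τ, (¬ (Below σ b a ↔ Below τ b a)) ↔ ¬ (Below σ a b ↔ Below τ a b) := by
    intro σ τ
    rw [← not_below σ h, ← not_below τ h]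
    tauto
  have key : ∀ c d : Fin n × ℤˣ, (c, d) = (a, b) ∨ (c, d) = (b, a) ∨ (c, d) = (opp a, opp b) ∨
      (c, d) = (opp b, opp a) → ∀ h1 : signedVal c < signedVal d ∧ 0 ≤ signedVal c + signedVal d,
      ∃ t : Root n, (t.1.1.1 = t.1.2.1 ↔ a.1 = b.1) ∧
      (∀ σ τ, Separates σ τ t ↔ ¬ (Below σ a b ↔ Below τ a b)) ∧
      ∀ t' : Root n, (t' = t ↔ t'.1 = (a, b) ∨ t'.1 = (b, a) ∨ t'.1 = (opp a, opp b) ∨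
        t'.1 = (opp b, opp a)) := by
    intro c d hcd h1
    refine ⟨⟨(c, d), h1⟩, ?_, ?_, ?_⟩
    · rcases hcd with hcd | hcd | hcd | hcd <;> obtain ⟨rfl, rfl⟩ := Prod.mk.inj hcd <;>
        simp [opp, eq_comm]
    · intro σ τ
      rcases hcd with hcd | hcd | hcd | hcd <;> obtain ⟨rfl, rfl⟩ := Prod.mk.inj hcd <;>
        simp only [Separates, below_opp, hsw]
    · rintro ⟨⟨e, f⟩, h2⟩
      simp only [Subtype.mk.injEq, Prod.mk.injEq, ← signedVal_injective.eq_iff, signedVal_opp]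
        at hcd h2 h1 ⊢
      omega
  -- The order of the pair and the sign of its sum decide which of `(a, b)`, `(b, a)`, `(-a, -b)`,
  -- `(-b, -a)` is a positive root.
  rcases lt_or_gt_of_ne hv with h1 | h1 <;>
    rcases le_or_gt 0 (signedVal a + signedVal b) with h2 | h2
  · exact key a b (by simp) ⟨h1, h2⟩
  · exact key (opp b) (opp a) (by simp) (by simp; omega)
  · exact key b a (by simp) (by omega)
  · exact key (opp a) (opp b) (by simp) (by simp; omega)

/-- The pair of points exchanged by a generator. -/
def wall {n : ℕ} (i : Fin n) : (Fin n × ℤˣ) × (Fin n × ℤˣ) :=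
  if i.val = 0 then ((i, -1), (i, 1)) else ((⟨i.val - 1, by omega⟩, 1), (i, 1))

theorem signedVal_wall_fst {n : ℕ} (i : Fin n) :
    signedVal (wall i).1 = if i.val = 0 then -1 else (i.val : ℤ) := by
  unfold wall
  split_ifs with h
  · simp [h]
  · simp; omega

theorem signedVal_wall_snd {n : ℕ} (i : Fin n) : signedVal (wall i).2 = i.val + 1 := by
  unfold wall
  split_ifs <;> simp

theorem signedVal_generator {n : ℕ} (i : Fin n) (p : Fin n × ℤˣ) :
    signedVal ((generator i).1 p) =
      if signedVal p = signedVal (wall i).1 then signedVal (wall i).2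
      else if signedVal p = signedVal (wall i).2 then signedVal (wall i).1
      else if signedVal p = -signedVal (wall i).1 then -signedVal (wall i).2
      else if signedVal p = -signedVal (wall i).2 then -signedVal (wall i).1
      else signedVal p := by
  by_cases h : i.val = 0
  · have e : (generator i).1 p = Equiv.swap (i, 1) (i, -1) p := by simp [generator, h]
    have e1 : wall i = ((i, -1), (i, 1)) := by simp [wall, h]
    rw [e, e1, Equiv.swap_apply_def]
    simp only [← signedVal_injective.eq_iff, apply_ite signedVal]
    simp only [signedVal_neg]
    split_ifs <;> omega
  · have e : (generator i).1 p = (Equiv.swap (⟨i.val - 1, by omega⟩ : Fin n) i p.1, p.2) := by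
      simp only [generator, h, if_false]
      rfl
    have e1 : wall i = ((⟨i.val - 1, by omega⟩, 1), (i, 1)) := by simp [wall, h]
    rw [e, e1, Equiv.swap_apply_def]
    obtain ⟨j, s⟩ := p
    simp only [Fin.ext_iff]
    rcases Int.units_eq_one_or s with rfl | rfl <;> simp only [signedVal_neg, signedVal_one] <;>
    · split_ifs <;> simp <;> omega

theorem generator_mul_self {n : ℕ} (i : Fin n) : generator i * generator i = 1 := by
  apply Subtype.ext
  ext1 p
  apply signedVal_injective
  change signedVal ((generator i).1 ((generator i).1 p)) = signedVal p
  rw [signedVal_generator, signedVal_generator, signedVal_wall_fst, signedVal_wall_snd]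
  split_ifs <;> omega

theorem generator_inv {n : ℕ} (i : Fin n) : (generator i)⁻¹ = generator i :=
  inv_eq_of_mul_eq_one_left (generator_mul_self i)

theorem wall_ne {n : ℕ} (i : Fin n) : (wall i).1 ≠ (wall i).2 := by
  rw [ne_eq, ← signedVal_injective.eq_iff, signedVal_wall_fst, signedVal_wall_snd]
  split_ifs <;> omega

theorem wall_fst_eq {n : ℕ} (i : Fin n) : (wall i).1.1 = (wall i).2.1 ↔ i.val = 0 := by
  rw [fst_eq_iff, signedVal_wall_fst, signedVal_wall_snd]
  split_ifs <;> omega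

/-- A generator reverses the order of exactly the pairs given by its wall. -/
theorem generator_reverses {n : ℕ} (i : Fin n) {a b : Fin n × ℤˣ} (h : a ≠ b) :
    (¬ (signedVal a < signedVal b ↔
      signedVal ((generator i).1 a) < signedVal ((generator i).1 b))) ↔
    (a, b) = ((wall i).1, (wall i).2) ∨ (a, b) = ((wall i).2, (wall i).1) ∨
      (a, b) = (opp (wall i).1, opp (wall i).2) ∨ (a, b) = (opp (wall i).2, opp (wall i).1) := by
  rw [signedVal_generator, signedVal_generator]
  simp only [ne_eq, Prod.mk.injEq, ← signedVal_injective.eq_iff, signedVal_opp,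
    signedVal_wall_fst, signedVal_wall_snd] at h ⊢
  have ha : signedVal a ≠ 0 := by
    obtain ⟨j, s⟩ := a
    rcases Int.units_eq_one_or s with rfl | rfl <;> simp <;> omega
  have hb : signedVal b ≠ 0 := by
    obtain ⟨j, s⟩ := b
    rcases Int.units_eq_one_or s with rfl | rfl <;> simp <;> omega
  generalize signedVal a = x at *
  generalize signedVal b = y at *
  split_ifs <;> omega

/-- The chambers of `σ` and `σ π_i` are separated by exactly one root. -/
theorem exists_separating_root {n : ℕ} (σ : hyperoctahedral n) (i : Fin n) :
    ∃ t : Root n, (t.1.1.1 = t.1.2.1 ↔ i.val = 0) ∧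
      (∀ t', Separates σ (σ * generator i) t' ↔ t' = t) ∧
      ∀ τ, Separates σ τ t ↔
        ¬ signedVal ((τ⁻¹ * σ).1 (wall i).1) < signedVal ((τ⁻¹ * σ).1 (wall i).2) := by
  have hne : σ.1 (wall i).1 ≠ σ.1 (wall i).2 := σ.1.injective.ne (wall_ne i)
  obtain ⟨t, h1, h2, h3⟩ := exists_root hne
  refine ⟨t, ?_, ?_, ?_⟩
  · rw [h1, fst_eq_iff, ← signedVal_opp, signedVal_injective.eq_iff, signedVal_injective.eq_iff,
      ← apply_opp, σ.1.injective.eq_iff, σ.1.injective.eq_iff, ← wall_fst_eq, fst_eq_iff,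
      ← signedVal_opp, signedVal_injective.eq_iff, signedVal_injective.eq_iff]
  · rintro ⟨⟨a, b⟩, hab⟩
    rw [h3]
    have hn : σ⁻¹.1 a ≠ σ⁻¹.1 b := σ⁻¹.1.injective.ne (by rintro rfl; exact lt_irrefl _ hab.1)
    have := generator_reverses i hn
    have e : ∀ p, (σ * generator i)⁻¹.1 p = (generator i).1 (σ⁻¹.1 p) := by
      intro p
      rw [mul_inv_rev, generator_inv]
      rfl
    have e' : ∀ p r, σ⁻¹.1 p = r ↔ p = σ.1 r := fun p r => Equiv.Perm.inv_eq_iff_eq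
    simp only [Separates, Below, e, this]
    simp only [Prod.mk.injEq, e', apply_opp]
  · intro τ
    rw [h2]
    have e : ∀ p, (τ⁻¹ * σ).1 p = τ⁻¹.1 (σ.1 p) := fun _ => rfl
    have e' : ∀ p, σ⁻¹.1 (σ.1 p) = p := fun p => σ.1.symm_apply_apply p
    simp only [Below, e, e', signedVal_wall_fst, signedVal_wall_snd]
    split_ifs <;> simp

/-! ### Length as a count of separating roots -/

/-- The wall inequalities say `0 < ρ(1) < ⋯ < ρ(n)`. Since these values are integers of absolute
value at most `n`, they are squeezed to `ρ(k) = k`. So the fundamental chamber is cut out by its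
walls alone. -/
theorem eq_one_of_wall_lt {n : ℕ} (ρ : hyperoctahedral n)
    (h : ∀ i : Fin n, signedVal (ρ.1 (wall i).1) < signedVal (ρ.1 (wall i).2)) : ρ = 1 := by
  have hopp : ∀ i : Fin n, signedVal (ρ.1 (i, -1)) = -signedVal (ρ.1 (i, 1)) := fun i => by
    rw [← signedVal_opp, ← apply_opp]
    rfl
  have hstep : ∀ (k : ℕ) (hk : k + 1 < n),
      signedVal (ρ.1 (⟨k, by omega⟩, 1)) < signedVal (ρ.1 (⟨k + 1, hk⟩, 1)) := by
    intro k hk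
    simpa [wall] using h ⟨k + 1, hk⟩
  have hlow : ∀ (k : ℕ) (hk : k < n), (k : ℤ) + 1 ≤ signedVal (ρ.1 (⟨k, hk⟩, 1)) := by
    intro k
    induction k with
    | zero =>
      intro hk
      have := h ⟨0, hk⟩
      simp only [wall, if_true] at this
      rw [hopp] at this
      push_cast
      omega
    | succ k ih =>
      intro hk
      have := ih (by omega)
      have := hstep k hk
      push_cast
      omega
  have hle : ∀ p : Fin n × ℤˣ, signedVal p ≤ n := by
    rintro ⟨i, s⟩
    rcases Int.units_eq_one_or s with rfl | rfl <;> simp <;> omega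
  -- Descending induction: `j` is the distance of `k` from the top position.
  have hup : ∀ (j k : ℕ) (hk : k < n), k + j + 1 = n →
      signedVal (ρ.1 (⟨k, hk⟩, 1)) ≤ (k : ℤ) + 1 := by
    intro j
    induction j with
    | zero =>
      intro k hk hj
      have := hle (ρ.1 (⟨k, hk⟩, 1))
      omega
    | succ j ih =>
      intro k hk hj
      have := ih (k + 1) (by omega) (by omega)
      have := hstep k (by omega)
      push_cast at *
      omega
  have hone : ∀ i : Fin n, ρ.1 (i, 1) = (i, 1) := by
    intro i
    apply signedVal_injective
    rw [signedVal_one]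
    exact le_antisymm (hup (n - 1 - i.val) i.val i.2 (by omega)) (hlow i.val i.2)
  apply Subtype.ext
  ext1 ⟨i, s⟩
  rcases Int.units_eq_one_or s with rfl | rfl
  · exact hone i
  · have := apply_opp ρ (i, 1)
    rw [hone] at this
    exact this

/-- A root is short when it is a multiple of a coordinate vector. -/
def IsShort {n : ℕ} (t : Root n) : Prop := t.1.1.1 = t.1.2.1

open Classical in
/-- The number of roots with the property `c` that separate two chambers. -/
noncomputable def sepCount {n : ℕ} (c : Root n → Prop) (σ τ : hyperoctahedral n) : ℕ :=
  (Finset.univ.filter fun t => c t ∧ Separates σ τ t).card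

theorem sepCount_self {n : ℕ} (c : Root n → Prop) (σ : hyperoctahedral n) :
    sepCount c σ σ = 0 := by
  simp [sepCount, Separates]

theorem sepCount_triangle {n : ℕ} (c : Root n → Prop) (σ τ ρ : hyperoctahedral n) :
    sepCount c σ ρ ≤ sepCount c σ τ + sepCount c τ ρ := by
  classical
  unfold sepCount
  refine le_trans (Finset.card_le_card ?_) (Finset.card_union_le _ _)
  intro t
  simp only [Finset.mem_filter, Finset.mem_univ, true_and, Finset.mem_union]
  simp only [Separates]
  tauto

/-- Each letter of the word crosses a single hyperplane, so a gallery needs at least one letter per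
separating root. The predicate `d` selects the letters whose hyperplanes belong to the class `c`; it
is used for the short and for the long roots. -/
theorem sepCount_le_countP {n : ℕ} (c : Root n → Prop) (d : Fin n → Bool)
    (hcd : ∀ (t : Root n) (i : Fin n), (IsShort t ↔ i.val = 0) → (c t ↔ d i))
    (w : List (Fin n)) (σ : hyperoctahedral n) :
    sepCount c σ (σ * wordProd w) ≤ w.countP d := by
  classical
  induction w generalizing σ with
  | nil => simp [wordProd, sepCount_self]
  | cons i w ih =>
    have e : σ * wordProd (i :: w) = σ * generator i * wordProd w := by
      simp [wordProd, mul_assoc]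
    rw [e, List.countP_cons, add_comm]
    refine (sepCount_triangle c σ (σ * generator i) _).trans (add_le_add ?_ (ih _))
    obtain ⟨t, h1, h2, -⟩ := exists_separating_root σ i
    have hc := hcd t i h1
    simp only [sepCount, h2]
    split_ifs with hd
    · refine (Finset.card_le_card (t := {t}) fun t' => ?_).trans (by simp)
      simp
    · rw [Nat.le_zero, Finset.card_eq_zero, Finset.filter_eq_empty_iff]
      rintro t' - ⟨h3, rfl⟩
      exact hd (hc.1 h3)

/-- Crossing a wall that separates `σ` from `τ` removes that root from the separating set and
changes nothing else. -/
theorem sepCount_step {n : ℕ} (c : Root n → Prop) {σ σ' τ : hyperoctahedral n} {t : Root n}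
    (ht : Separates σ τ t) (h : ∀ t', Separates σ σ' t' ↔ t' = t) :
    open Classical in sepCount c σ τ = sepCount c σ' τ + if c t then 1 else 0 := by
  classical
  have h2 : ∀ t', Separates σ' τ t' ↔ Separates σ τ t' ∧ t' ≠ t := by
    intro t'
    have := h t'
    by_cases e : t' = t
    · subst e
      simp only [Separates] at *
      tauto
    · simp only [Separates] at *
      tauto
  have e : (Finset.univ.filter fun t' => c t' ∧ Separates σ' τ t') =
      (Finset.univ.filter fun t' => c t' ∧ Separates σ τ t').erase t := by
    ext t'
    simp only [Finset.mem_filter, Finset.mem_univ, true_and, Finset.mem_erase, h2]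
    tauto
  unfold sepCount
  rw [e]
  split_ifs with hc
  · rw [Finset.card_erase_add_one]
    simp [hc, ht]
  · rw [Finset.erase_eq_of_notMem, add_zero]
    simp [hc]

/-- Greedy gallery: as long as the chambers differ, some wall of the current chamber separates it
from `τ` by `eq_one_of_wall_lt`, and crossing it brings `τ` closer. The word thus attains both lower
bounds of `sepCount_le_countP` at once. -/
theorem exists_word {n : ℕ} (σ τ : hyperoctahedral n) :
    ∃ w : List (Fin n), σ * wordProd w = τ ∧
      w.countP (fun i => i.val = 0) = sepCount IsShort σ τ ∧
      w.countP (fun i => i.val ≠ 0) = sepCount (fun t => ¬ IsShort t) σ τ := by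
  classical
  generalize hk : sepCount (fun _ => True) σ τ = k
  induction k generalizing σ with
  | zero =>
    have h0 : ∀ t, ¬ Separates σ τ t := by
      intro t ht
      apply Finset.notMem_empty t
      rw [← Finset.card_eq_zero.1 hk]
      simp [ht]
    have : τ⁻¹ * σ = 1 := by
      refine eq_one_of_wall_lt _ fun i => ?_
      obtain ⟨t, -, -, h3⟩ := exists_separating_root σ i
      exact not_not.1 (mt (h3 τ).2 (h0 t))
    refine ⟨[], ?_, ?_, ?_⟩
    · rw [inv_mul_eq_one] at this
      simp [wordProd, this]
    · simp [sepCount, h0]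
    · simp [sepCount, h0]
  | succ k ih =>
    have : ∃ i : Fin n, ¬ signedVal ((τ⁻¹ * σ).1 (wall i).1) <
        signedVal ((τ⁻¹ * σ).1 (wall i).2) := by
      by_contra! hcon
      have h1 := eq_one_of_wall_lt _ hcon
      rw [inv_mul_eq_one] at h1
      rw [h1, sepCount_self] at hk
      omega
    obtain ⟨i, hi⟩ := this
    obtain ⟨t, h1, h2, h3⟩ := exists_separating_root σ i
    have hs := (h3 τ).2 hi
    rw [sepCount_step _ hs h2] at hk
    obtain ⟨w, hw, hw1, hw2⟩ := ih (σ * generator i) (by simpa using hk)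
    refine ⟨i :: w, ?_, ?_, ?_⟩
    · rw [← hw]
      simp [wordProd, mul_assoc]
    · rw [sepCount_step _ hs h2, List.countP_cons, hw1]
      congr 1
      simp [IsShort, h1]
    · rw [sepCount_step _ hs h2, List.countP_cons, hw2]
      congr 1
      simp [IsShort, h1]

theorem length_eq_countP_add {n : ℕ} (w : List (Fin n)) :
    w.length = w.countP (fun i => i.val = 0) + w.countP (fun i => i.val ≠ 0) := by
  rw [List.length_eq_countP_add_countP (fun i : Fin n => decide (i.val = 0))]
  simp

theorem eq_of_forall_not_separates {n : ℕ} {σ τ : hyperoctahedral n}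
    (h : ∀ t, ¬ Separates σ τ t) : σ = τ := by
  obtain ⟨w, hw, h1, h2⟩ := exists_word σ τ
  have h0 : w = [] := by
    rw [← List.length_eq_zero_iff, length_eq_countP_add, h1, h2]
    simp [sepCount, h]
  simpa [h0, wordProd] using hw

theorem sepCount_short_le {n : ℕ} (w : List (Fin n)) (σ : hyperoctahedral n) :
    sepCount IsShort σ (σ * wordProd w) ≤ w.countP (fun i => i.val = 0) :=
  sepCount_le_countP _ _ (by simp) w σ

theorem sepCount_long_le {n : ℕ} (w : List (Fin n)) (σ : hyperoctahedral n) :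
    sepCount (fun t => ¬ IsShort t) σ (σ * wordProd w) ≤ w.countP (fun i => i.val ≠ 0) :=
  sepCount_le_countP _ _ (by intro t i h; simp [h]) w σ

/-- In a reduced word of `σ⁻¹ τ`, the letters count the roots separating `σ` and `τ`. -/
theorem countP_of_isReducedWord {n : ℕ} {σ τ : hyperoctahedral n} {w : List (Fin n)}
    (h : IsReducedWord (σ⁻¹ * τ) w) :
    w.countP (fun i => i.val = 0) = sepCount IsShort σ τ ∧
      w.countP (fun i => i.val ≠ 0) = sepCount (fun t => ¬ IsShort t) σ τ := by
  obtain ⟨w', hw, h1, h2⟩ := exists_word σ τ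
  have hle := h.2 w' (by rw [← hw]; group)
  have e : σ * wordProd w = τ := by rw [h.1]; group
  have h3 := sepCount_short_le w σ
  have h4 := sepCount_long_le w σ
  rw [e] at h3 h4
  -- Both counts are at least the numbers of separating roots, while their sum is at most the total,
  -- so both are equalities.
  rw [length_eq_countP_add, length_eq_countP_add w'] at hle
  omega

theorem isReducedWord_of_countP {n : ℕ} {σ τ : hyperoctahedral n} {w : List (Fin n)}
    (hw : σ * wordProd w = τ) (h1 : w.countP (fun i => i.val = 0) = sepCount IsShort σ τ)
    (h2 : w.countP (fun i => i.val ≠ 0) = sepCount (fun t => ¬ IsShort t) σ τ) :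
    IsReducedWord (σ⁻¹ * τ) w := by
  refine ⟨by rw [← hw]; group, fun w' hw' => ?_⟩
  have e : σ * wordProd w' = τ := by rw [hw']; group
  have h3 := sepCount_short_le w' σ
  have h4 := sepCount_long_le w' σ
  rw [e] at h3 h4
  rw [length_eq_countP_add, length_eq_countP_add w']
  omega

/-- All reduced words have the same number of letters `π_0`, so the infimum defining `l₁` runs over
a singleton. -/
theorem l₁_inv_mul {n : ℕ} (σ τ : hyperoctahedral n) :
    l₁ (σ⁻¹ * τ) = sepCount IsShort σ τ := by
  obtain ⟨w, hw, h1, h2⟩ := exists_word σ τ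
  have : {k | ∃ w, IsReducedWord (σ⁻¹ * τ) w ∧ k = w.countP (fun i => i.val = 0)} =
      {sepCount IsShort σ τ} := by
    ext k
    constructor
    · rintro ⟨w', hw', rfl⟩
      exact (countP_of_isReducedWord hw').1
    · rintro rfl
      exact ⟨w, isReducedWord_of_countP hw h1 h2, h1.symm⟩
  rw [l₁, this, csInf_singleton]

theorem l₂_inv_mul {n : ℕ} (σ τ : hyperoctahedral n) :
    l₂ (σ⁻¹ * τ) = sepCount (fun t => ¬ IsShort t) σ τ := by
  obtain ⟨w, hw, h1, h2⟩ := exists_word σ τ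
  have : {k | ∃ w, IsReducedWord (σ⁻¹ * τ) w ∧ k = w.countP (fun i => i.val ≠ 0)} =
      {sepCount (fun t => ¬ IsShort t) σ τ} := by
    ext k
    constructor
    · rintro ⟨w', hw', rfl⟩
      exact (countP_of_isReducedWord hw').2
    · rintro rfl
      exact ⟨w, isReducedWord_of_countP hw h1 h2, h2.symm⟩
  rw [l₂, this, csInf_singleton]

theorem sepCount_comm {n : ℕ} (c : Root n → Prop) (σ τ : hyperoctahedral n) :
    sepCount c σ τ = sepCount c τ σ := by
  have h : Separates σ τ = Separates τ σ := funext fun t => propext (not_congr iff_comm)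
  rw [sepCount, sepCount, h]

theorem l₁_inv {n : ℕ} (σ : hyperoctahedral n) : l₁ σ⁻¹ = l₁ σ := by
  have h1 := l₁_inv_mul σ 1
  have h2 := l₁_inv_mul 1 σ
  simp only [mul_one, inv_one, one_mul] at h1 h2
  rw [h1, h2, sepCount_comm]

theorem l₂_inv {n : ℕ} (σ : hyperoctahedral n) : l₂ σ⁻¹ = l₂ σ := by
  have h1 := l₂_inv_mul σ 1
  have h2 := l₂_inv_mul 1 σ
  simp only [mul_one, inv_one, one_mul] at h1 h2
  rw [h1, h2, sepCount_comm]

/-- The weight `α^{l₁(σ)} q^{l₂(σ)}`. -/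
noncomputable def weight (α q : ℝ) {n : ℕ} (σ : hyperoctahedral n) : ℝ := α ^ l₁ σ * q ^ l₂ σ

theorem weight_inv (α q : ℝ) {n : ℕ} (σ : hyperoctahedral n) :
    weight α q σ⁻¹ = weight α q σ := by
  rw [weight, l₁_inv, l₂_inv, weight]

open Classical in
/-- The parameter attached to a root. -/
noncomputable def rootParam (α q : ℝ) {n : ℕ} (t : Root n) : ℝ := if IsShort t then α else q

open Classical in
theorem weight_inv_mul (α q : ℝ) {n : ℕ} (σ τ : hyperoctahedral n) :
    weight α q (σ⁻¹ * τ) =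
      ∏ t : Root n, if Separates σ τ t then rootParam α q t else 1 := by
  rw [weight, l₁_inv_mul, l₂_inv_mul, sepCount, sepCount, ← Finset.prod_const,
    ← Finset.prod_const, Finset.prod_filter, Finset.prod_filter, ← Finset.prod_mul_distrib]
  refine Finset.prod_congr rfl fun t _ => ?_
  by_cases h1 : IsShort t <;> by_cases h2 : Separates σ τ t <;> simp [h1, h2, rootParam]

/-! ### Strict positivity of product kernels -/

section Kernel

variable {ι T V : Type*}

open Classical in
/-- The product over `t ∈ s` of the kernels equal to `1` where `χ · t` agrees and to `c t`
elsewhere. -/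
noncomputable def agreeKernel (χ : ι → T → Prop) (c : T → ℝ) (s : Finset T) (a b : ι) : ℝ :=
  ∏ t ∈ s, if χ a t ↔ χ b t then 1 else c t

variable [Fintype ι] [AddCommGroup V] [Module ℂ V]

/-- The real quadratic form `∑ k(a, b) Re ⟨F a, F b⟩`. -/
noncomputable def kernelForm (B : V →ₗ⋆[ℂ] V →ₗ[ℂ] ℂ) (k : ι → ι → ℝ) (F : ι → V) : ℝ :=
  ∑ a, ∑ b, k a b * (B (F a) (F b)).re

theorem kernelForm_smul (B : V →ₗ⋆[ℂ] V →ₗ[ℂ] ℂ) (k : ι → ι → ℝ) (φ : ι → ℝ) (F : ι → V) :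
    kernelForm B k (fun a => (φ a : ℂ) • F a) =
      kernelForm B (fun a b => k a b * (φ a * φ b)) F := by
  unfold kernelForm
  refine Finset.sum_congr rfl fun a _ => Finset.sum_congr rfl fun b _ => ?_
  simp only [map_smulₛₗ, LinearMap.smul_apply, Complex.conj_ofReal, smul_eq_mul,
    RingHom.id_apply, Complex.re_ofReal_mul]
  ring

theorem kernelForm_add (B : V →ₗ⋆[ℂ] V →ₗ[ℂ] ℂ) (k k' : ι → ι → ℝ) (F : ι → V) :
    kernelForm B (fun a b => k a b + k' a b) F = kernelForm B k F + kernelForm B k' F := by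
  simp only [kernelForm, add_mul, Finset.sum_add_distrib]

theorem kernelForm_const_mul (B : V →ₗ⋆[ℂ] V →ₗ[ℂ] ℂ) (r : ℝ) (k : ι → ι → ℝ) (F : ι → V) :
    kernelForm B (fun a b => r * k a b) F = r * kernelForm B k F := by
  simp only [kernelForm, mul_assoc, Finset.mul_sum]

/-- A factor equal to `1` on agreement and `c` otherwise is `(1 - |c|) (e eᵀ + e' e'ᵀ) + |c| δ δᵀ`.
Here `e`, `e'` are the indicators of the two classes, and `δ` is constantly `1` if `c ≥ 0` and `±1`
according to the class if `c < 0`. The same `e`, `e'` give the factor with `c = 0`, which permits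
comparison of the two kernels. -/
theorem kernelForm_agreeKernel_insert (B : V →ₗ⋆[ℂ] V →ₗ[ℂ] ℂ) (χ : ι → T → Prop) (c : T → ℝ)
    {s : Finset T} {t : T} (ht : t ∉ s) : ∃ e e' δ : ι → ℝ,
      (∀ F : ι → V, kernelForm B (agreeKernel χ c (Finset.cons t s ht)) F =
        (1 - |c t|) * (kernelForm B (agreeKernel χ c s) (fun a => (e a : ℂ) • F a) +
          kernelForm B (agreeKernel χ c s) (fun a => (e' a : ℂ) • F a)) +
        |c t| * kernelForm B (agreeKernel χ c s) (fun a => (δ a : ℂ) • F a)) ∧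
      ∀ F : ι → V, kernelForm B (agreeKernel χ 0 (Finset.cons t s ht)) F =
        kernelForm B (agreeKernel χ 0 s) (fun a => (e a : ℂ) • F a) +
          kernelForm B (agreeKernel χ 0 s) (fun a => (e' a : ℂ) • F a) := by
  classical
  refine ⟨fun a => if χ a t then 1 else 0, fun a => if χ a t then 0 else 1,
    fun a => if 0 ≤ c t ∨ χ a t then 1 else -1, fun F => ?_, fun F => ?_⟩
  · rw [kernelForm_smul, kernelForm_smul, kernelForm_smul, ← kernelForm_add,
      ← kernelForm_const_mul, ← kernelForm_const_mul, ← kernelForm_add]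
    congr 1
    ext a b
    rw [agreeKernel, Finset.prod_cons]
    change _ * agreeKernel χ c s a b = _
    rcases le_or_gt 0 (c t) with h | h
    · rw [abs_of_nonneg h]
      by_cases h1 : χ a t <;> by_cases h2 : χ b t <;> simp [h1, h2, h] <;> ring
    · rw [abs_of_neg h]
      by_cases h1 : χ a t <;> by_cases h2 : χ b t <;> simp [h1, h2, not_le.2 h] <;> ring
  · rw [kernelForm_smul, kernelForm_smul, ← kernelForm_add]
    congr 1
    ext a b
    rw [agreeKernel, Finset.prod_cons]
    change _ * agreeKernel χ 0 s a b = _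
    by_cases h1 : χ a t <;> by_cases h2 : χ b t <;> simp [h1, h2]

/-- Split off one factor at a time and discard the nonnegative `δ` term. The family `F` must vary in
the induction because the splitting rescales it. -/
theorem kernelForm_agreeKernel_ge (B : V →ₗ⋆[ℂ] V →ₗ[ℂ] ℂ) (hB : ∀ v, 0 ≤ (B v v).re)
    (χ : ι → T → Prop) (c : T → ℝ) (hc : ∀ t, |c t| < 1) (s : Finset T) (F : ι → V) :
    0 ≤ kernelForm B (agreeKernel χ 0 s) F ∧
    (∏ t ∈ s, (1 - |c t|)) * kernelForm B (agreeKernel χ 0 s) F ≤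
      kernelForm B (agreeKernel χ c s) F := by
  induction s using Finset.cons_induction generalizing F with
  | empty =>
    have h : ∀ d, kernelForm B (agreeKernel χ d ∅) F = (B (∑ a, F a) (∑ a, F a)).re := by
      intro d
      simp only [kernelForm, agreeKernel, Finset.prod_empty, one_mul, map_sum,
        LinearMap.sum_apply, Complex.re_sum]
      exact Finset.sum_comm
    rw [h, h, Finset.prod_empty, one_mul]
    exact ⟨hB _, le_rfl⟩
  | cons t s ht ih =>
    obtain ⟨e, e', δ, h1, h2⟩ := kernelForm_agreeKernel_insert B χ c ht
    rw [h1, h2, Finset.prod_cons]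
    have hp : 0 ≤ ∏ t ∈ s, (1 - |c t|) :=
      Finset.prod_nonneg fun t _ => sub_nonneg.2 (hc t).le
    have i1 := ih (fun a => (e a : ℂ) • F a)
    have i2 := ih (fun a => (e' a : ℂ) • F a)
    have i3 := ih (fun a => (δ a : ℂ) • F a)
    have i4 := mul_nonneg (abs_nonneg (c t)) ((mul_nonneg hp i3.1).trans i3.2)
    have i5 := mul_le_mul_of_nonneg_left (add_le_add i1.2 i2.2) (sub_nonneg.2 (hc t).le)
    exact ⟨add_nonneg i1.1 i2.1, by linarith⟩

/-- When `χ` separates the points of `ι`, the kernel with all parameters `0` is the identity matrix;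
this is where strictness comes from. -/
theorem kernelForm_agreeKernel_univ_ge [Fintype T] (B : V →ₗ⋆[ℂ] V →ₗ[ℂ] ℂ)
    (hB : ∀ v, 0 ≤ (B v v).re) (χ : ι → T → Prop) (hχ : Function.Injective χ) (c : T → ℝ)
    (hc : ∀ t, |c t| < 1) (F : ι → V) :
    (∏ t, (1 - |c t|)) * ∑ a, (B (F a) (F a)).re ≤
      kernelForm B (agreeKernel χ c Finset.univ) F := by
  classical
  refine le_trans (le_of_eq ?_) (kernelForm_agreeKernel_ge B hB χ c hc Finset.univ F).2
  congr 1
  refine Finset.sum_congr rfl fun a _ => ?_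
  rw [Finset.sum_eq_single a]
  · simp [agreeKernel]
  · intro b _ hb
    obtain ⟨t, ht⟩ : ∃ t, ¬ (χ a t ↔ χ b t) := by
      by_contra! hcon
      exact hb (hχ (funext fun t => propext (hcon t))).symm
    rw [agreeKernel, Finset.prod_eq_zero (Finset.mem_univ t), zero_mul]
    simp [ht]
  · simp

end Kernel

/-! ### The free inner product on tensor powers -/

section Fock

variable {H : Type*} [NormedAddCommGroup H] [InnerProductSpace ℂ H]

theorem tensor_induction {n : ℕ} {p : (⨂[ℂ]^n H) → Prop} (f : ⨂[ℂ]^n H)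
    (tprod : ∀ x, p (PiTensorProduct.tprod ℂ x)) (zero : p 0)
    (add : ∀ f g, p f → p g → p (f + g)) (smul : ∀ (c : ℂ) f, p f → p (c • f)) : p f := by
  have hf : f ∈ Submodule.span ℂ (Set.range (PiTensorProduct.tprod ℂ (s := fun _ : Fin n => H))) :=
    PiTensorProduct.span_tprod_eq_top (R := ℂ) (s := fun _ : Fin n => H) ▸ Submodule.mem_top
  refine Submodule.span_induction (p := fun f _ => p f) ?_ zero (fun f g _ _ => add f g)
    (fun c f _ => smul c f) hf
  rintro _ ⟨x, rfl⟩
  exact tprod x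

theorem tensorInner_conj {n : ℕ} (f g : ⨂[ℂ]^n H) :
    conj (tensorInner n f g) = tensorInner n g f := by
  induction f using tensor_induction with
  | zero => simp
  | add f f' h h' => simp [h, h']
  | smul c f h => simp [h]
  | tprod x =>
    induction g using tensor_induction with
    | zero => simp
    | add f f' h h' => simp [h, h']
    | smul c f h => simp [h]
    | tprod y =>
      simp [tensorInner_tprod]

/-- Every tensor is a combination of elementary tensors of vectors in an orthonormal family. -/
theorem exists_orthonormal_expansion {n : ℕ} (f : ⨂[ℂ]^n H) :
    ∃ (d : ℕ) (e : Fin d → H) (c : (Fin n → Fin d) → ℂ), Orthonormal ℂ e ∧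
      f = ∑ I, c I • PiTensorProduct.tprod ℂ (e ∘ I) := by
  have hmono : ∀ W W' : Submodule ℂ H, W ≤ W' →
      Submodule.span ℂ (PiTensorProduct.tprod ℂ '' {x : Fin n → H | ∀ i, x i ∈ W}) ≤
        Submodule.span ℂ (PiTensorProduct.tprod ℂ '' {x : Fin n → H | ∀ i, x i ∈ W'}) := by
    intro W W' h
    apply Submodule.span_mono
    apply Set.image_mono
    intro x hx i
    exact h (hx i)
  -- A tensor involves finitely many vectors, so it lives over a finite-dimensional subspace, where
  -- an orthonormal basis is available.
  have key : ∃ W : Submodule ℂ H, FiniteDimensional ℂ W ∧ f ∈ Submodule.span ℂ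
      (PiTensorProduct.tprod ℂ '' {x : Fin n → H | ∀ i, x i ∈ W}) := by
    induction f using tensor_induction with
    | zero => exact ⟨⊥, inferInstance, zero_mem _⟩
    | tprod x => exact ⟨Submodule.span ℂ (Set.range x),
        FiniteDimensional.span_of_finite ℂ (Set.finite_range x),
        Submodule.subset_span ⟨x, fun i => Submodule.subset_span ⟨i, rfl⟩, rfl⟩⟩
    | add f g ihf ihg =>
      obtain ⟨W, hW, hf⟩ := ihf
      obtain ⟨W', hW', hg⟩ := ihg
      refine ⟨W ⊔ W', inferInstance, add_mem ?_ ?_⟩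
      · exact hmono W _ le_sup_left hf
      · exact hmono W' _ le_sup_right hg
    | smul c f ihf =>
      obtain ⟨W, hW, hf⟩ := ihf
      exact ⟨W, hW, Submodule.smul_mem _ _ hf⟩
  obtain ⟨W, hW, hf⟩ := key
  let b := stdOrthonormalBasis ℂ W
  let e : Fin (Module.finrank ℂ W) → H := fun i => (b i : H)
  have he : Orthonormal ℂ e := b.orthonormal.comp_linearIsometry W.subtypeₗᵢ
  have hf' : f ∈ Submodule.span ℂ (Set.range fun I : Fin n → Fin (Module.finrank ℂ W) =>
      PiTensorProduct.tprod ℂ (e ∘ I)) := by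
    refine Submodule.span_le.2 ?_ hf
    rintro _ ⟨x, hx, rfl⟩
    have hx' : x = fun i => ∑ j, (b.repr ⟨x i, hx i⟩ j) • e j := by
      ext i
      have := congrArg (Subtype.val) (b.sum_repr ⟨x i, hx i⟩)
      simpa [e] using this.symm
    rw [hx', MultilinearMap.map_sum]
    refine Submodule.sum_mem _ fun I _ => ?_
    rw [MultilinearMap.map_smul_univ]
    exact Submodule.smul_mem _ _ (Submodule.subset_span ⟨I, rfl⟩)
  obtain ⟨c, hc⟩ := (Submodule.mem_span_range_iff_exists_fun ℂ).1 hf'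
  exact ⟨_, e, c, he, hc.symm⟩

theorem tensorInner_self_eq_sum {n d : ℕ} {e : Fin d → H} (he : Orthonormal ℂ e)
    (c : (Fin n → Fin d) → ℂ) :
    (tensorInner n (∑ I, c I • PiTensorProduct.tprod ℂ (e ∘ I))
      (∑ I, c I • PiTensorProduct.tprod ℂ (e ∘ I))).re = ∑ I, ‖c I‖ ^ 2 := by
  have h : ∀ I J : Fin n → Fin d, tensorInner n (PiTensorProduct.tprod ℂ (e ∘ I))
      (PiTensorProduct.tprod ℂ (e ∘ J)) = if I = J then 1 else 0 := by
    intro I J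
    rw [tensorInner_tprod]
    simp only [Function.comp_apply, orthonormal_iff_ite.1 he]
    split_ifs with hIJ
    · subst hIJ
      simp
    · obtain ⟨i, hi⟩ := Function.ne_iff.1 hIJ
      exact Finset.prod_eq_zero (Finset.mem_univ i) (by simp [hi])
  simp only [map_sum, LinearMap.sum_apply, map_smulₛₗ, LinearMap.smul_apply, h, smul_eq_mul,
    mul_ite, mul_one, mul_zero, Finset.sum_ite_eq', Finset.mem_univ, if_true,
    RingHom.id_apply, Complex.re_sum]
  refine Finset.sum_congr rfl fun I _ => ?_
  simp [← Complex.normSq_eq_norm_sq, Complex.normSq_apply]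

theorem tensorInner_self_nonneg {n : ℕ} (f : ⨂[ℂ]^n H) : 0 ≤ (tensorInner n f f).re := by
  obtain ⟨d, e, c, he, rfl⟩ := exists_orthonormal_expansion f
  rw [tensorInner_self_eq_sum he]
  positivity

theorem tensorInner_self_pos {n : ℕ} {f : ⨂[ℂ]^n H} (hf : f ≠ 0) :
    0 < (tensorInner n f f).re := by
  refine (tensorInner_self_nonneg f).lt_of_ne' fun h0 => hf ?_
  obtain ⟨d, e, c, he, rfl⟩ := exists_orthonormal_expansion f
  rw [tensorInner_self_eq_sum he, Finset.sum_eq_zero_iff_of_nonneg fun _ _ => by positivity] at h0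
  refine Finset.sum_eq_zero fun I hI => ?_
  have := h0 I hI
  simp only [ne_eq, OfNat.ofNat_ne_zero, not_false_eq_true, pow_eq_zero_iff, norm_eq_zero] at this
  rw [this, zero_smul]

/-! ### The action of the hyperoctahedral group -/

/-- The vector `x_i` or `J x_i`, according to the sign of a point. -/
def signedVec (J : H →ₗ[ℂ] H) {n : ℕ} (x : Fin n → H) (p : Fin n × ℤˣ) : H :=
  if p.2 = 1 then x p.1 else J (x p.1)

@[simp] theorem signedVec_one (J : H →ₗ[ℂ] H) {n : ℕ} (x : Fin n → H) (i : Fin n) :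
    signedVec J x (i, 1) = x i := by simp [signedVec]

@[simp] theorem signedVec_neg_one (J : H →ₗ[ℂ] H) {n : ℕ} (x : Fin n → H) (i : Fin n) :
    signedVec J x (i, -1) = J (x i) := by simp [signedVec]

theorem signedVec_opp {J : H →ₗ[ℂ] H} (hJ : ∀ x, J (J x) = x) {n : ℕ} (x : Fin n → H)
    (p : Fin n × ℤˣ) : signedVec J x (opp p) = J (signedVec J x p) := by
  obtain ⟨i, s⟩ := p
  rcases Int.units_eq_one_or s with rfl | rfl <;> simp [opp, hJ]

theorem action_tprod (J : H →ₗ[ℂ] H) {n : ℕ} (σ : hyperoctahedral n) (x : Fin n → H) :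
    action J σ (PiTensorProduct.tprod ℂ x) =
      PiTensorProduct.tprod ℂ fun i => signedVec J x (σ⁻¹.1 (i, 1)) := by
  rw [action, LinearMap.comp_apply, PiTensorProduct.map_tprod, LinearEquiv.coe_coe,
    PiTensorProduct.reindex_tprod]
  congr 1
  ext i
  have e : (absPerm σ).symm i = (σ⁻¹.1 (i, 1)).1 := rfl
  have e' : σ.1 (σ⁻¹.1 (i, 1)) = (i, 1) := σ.1.apply_symm_apply _
  rw [e]
  generalize σ⁻¹.1 (i, 1) = p at *
  obtain ⟨j, s⟩ := p
  rcases Int.units_eq_one_or s with rfl | rfl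
  · simp [e']
  · have := apply_opp σ (j, -1)
    rw [e'] at this
    simp only [opp, neg_neg] at this
    simp [this]

theorem action_mul {J : H →ₗ[ℂ] H} (hJ : ∀ x, J (J x) = x) {n : ℕ} (σ τ : hyperoctahedral n)
    (f : ⨂[ℂ]^n H) : action J (σ * τ) f = action J σ (action J τ f) := by
  induction f using tensor_induction with
  | zero => simp
  | add f f' h h' => simp [h, h']
  | smul c f h => simp [h]
  | tprod x =>
    rw [action_tprod, action_tprod, action_tprod]
    congr 1
    ext i
    have e : (σ * τ)⁻¹.1 (i, 1) = τ⁻¹.1 (σ⁻¹.1 (i, 1)) := by rw [mul_inv_rev]; rfl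
    rw [e]
    generalize σ⁻¹.1 (i, 1) = p
    obtain ⟨j, s⟩ := p
    rcases Int.units_eq_one_or s with rfl | rfl
    · simp
    · have := apply_opp τ⁻¹ (j, 1)
      rw [signedVec_neg_one, ← signedVec_opp hJ, ← this]
      rfl

theorem tensorInner_action {J : H →ₗ[ℂ] H} (hJs : J.IsSymmetric) {n : ℕ}
    (σ : hyperoctahedral n) (f g : ⨂[ℂ]^n H) :
    tensorInner n (action J σ f) g = tensorInner n f (action J σ⁻¹ g) := by
  induction f using tensor_induction with
  | zero => simp
  | add f f' h h' => simp [h, h']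
  | smul c f h => simp [h]
  | tprod x =>
    induction g using tensor_induction with
    | zero => simp
    | add f f' h h' => simp [h, h']
    | smul c f h => simp [h]
    | tprod y =>
      rw [action_tprod, action_tprod, tensorInner_tprod, tensorInner_tprod, inv_inv]
      refine Fintype.prod_equiv (absPerm σ).symm _ _ fun i => ?_
      have e : (absPerm σ).symm i = (σ⁻¹.1 (i, 1)).1 := rfl
      have e' : σ.1 (σ⁻¹.1 (i, 1)) = (i, 1) := σ.1.apply_symm_apply _
      rw [e]
      generalize σ⁻¹.1 (i, 1) = p at *
      obtain ⟨j, s⟩ := p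
      rcases Int.units_eq_one_or s with rfl | rfl
      · simp [e']
      · have := apply_opp σ (j, -1)
        rw [e'] at this
        simp only [opp, neg_neg] at this
        simp only [this, signedVec_neg_one]
        exact hJs _ _

theorem action_inv_apply {J : H →ₗ[ℂ] H} (hJ : ∀ x, J (J x) = x) {n : ℕ}
    (σ : hyperoctahedral n) (f : ⨂[ℂ]^n H) : action J σ⁻¹ (action J σ f) = f := by
  rw [← action_mul hJ, inv_mul_cancel]
  induction f using tensor_induction with
  | zero => simp
  | add f f' h h' => simp [h, h']
  | smul c f h => simp [h]
  | tprod x =>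
    rw [action_tprod]
    simp

/-! ### The deformed form on tensor powers -/

theorem symmetrization_apply (J : H →ₗ[ℂ] H) (α q : ℝ) {n : ℕ} (f : ⨂[ℂ]^n H) :
    symmetrization J α q n f = ∑ σ, (weight α q σ : ℂ) • action J σ f := by
  simp [symmetrization, weight, LinearMap.sum_apply]

theorem tensorInner_symmetrization_conj {J : H →ₗ[ℂ] H} (hJs : J.IsSymmetric) (α q : ℝ) {n : ℕ}
    (f g : ⨂[ℂ]^n H) :
    conj (tensorInner n f (symmetrization J α q n g)) =
      tensorInner n g (symmetrization J α q n f) := by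
  rw [tensorInner_conj, symmetrization_apply, symmetrization_apply]
  simp only [map_sum, LinearMap.sum_apply, map_smulₛₗ, LinearMap.smul_apply, Complex.conj_ofReal,
    tensorInner_action hJs, RingHom.id_apply]
  exact Fintype.sum_equiv (Equiv.inv _) _ _ fun σ => by simp [weight_inv]

/-- Each `σ` acts unitarily, so `⟨f, ρ f⟩ = ⟨σ f, σ ρ f⟩`. Summing over `σ` and substituting `τ = σ
ρ` gives the form of the weight kernel on the orbit of `f`. -/
theorem card_mul_tensorInner_symmetrization {J : H →ₗ[ℂ] H} (hJs : J.IsSymmetric)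
    (hJ : ∀ x, J (J x) = x) (α q : ℝ) {n : ℕ} (f : ⨂[ℂ]^n H) :
    (Fintype.card (hyperoctahedral n) : ℝ) *
        (tensorInner n f (symmetrization J α q n f)).re =
      kernelForm (tensorInner n) (fun σ τ : hyperoctahedral n => weight α q (σ⁻¹ * τ))
        fun σ => action J σ f := by
  rw [kernelForm, ← nsmul_eq_mul, ← Finset.card_univ, ← Finset.sum_const]
  refine Finset.sum_congr rfl fun σ _ => ?_
  rw [symmetrization_apply, map_sum, Complex.re_sum]
  refine Fintype.sum_equiv (Equiv.mulLeft σ) _ _ fun ρ => ?_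
  simp only [Equiv.coe_mulLeft, inv_mul_cancel_left, tensorInner_action hJs, action_mul hJ,
    action_inv_apply hJ, map_smul, smul_eq_mul, Complex.re_ofReal_mul]

theorem below_injective {n : ℕ} : Function.Injective
    fun (σ : hyperoctahedral n) (t : Root n) => Below σ t.1.1 t.1.2 := by
  intro σ τ h
  refine eq_of_forall_not_separates fun t => ?_
  have := congrFun h t
  simp only [Separates, this, not_true_eq_false, not_false_eq_true]

theorem symmetrization_pos {J : H →ₗ[ℂ] H} (hJs : J.IsSymmetric)
    (hJ : ∀ x, J (J x) = x) {α q : ℝ} (hα : |α| < 1) (hq : |q| < 1) {n : ℕ} {f : ⨂[ℂ]^n H}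
    (hf : f ≠ 0) : 0 < (tensorInner n f (symmetrization J α q n f)).re := by
  classical
  have hcard : (0 : ℝ) < Fintype.card (hyperoctahedral n) := by exact_mod_cast Fintype.card_pos
  refine pos_of_mul_pos_right (a := (Fintype.card (hyperoctahedral n) : ℝ)) ?_ hcard.le
  rw [card_mul_tensorInner_symmetrization hJs hJ]
  have hp : ∀ t : Root n, |rootParam α q t| < 1 := fun t => by
    unfold rootParam
    split_ifs <;> assumption
  have h := kernelForm_agreeKernel_univ_ge (tensorInner n) tensorInner_self_nonneg _
    (below_injective (n := n)) (rootParam α q) hp fun σ => action J σ f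
  have e : agreeKernel (fun (σ : hyperoctahedral n) (t : Root n) => Below σ t.1.1 t.1.2)
      (rootParam α q) Finset.univ = fun σ τ => weight α q (σ⁻¹ * τ) := by
    ext σ τ
    rw [weight_inv_mul, agreeKernel]
    refine Finset.prod_congr rfl fun t _ => ?_
    by_cases h : Below σ t.1.1 t.1.2 ↔ Below τ t.1.1 t.1.2 <;> simp only [Separates, h] <;> simp
  rw [e] at h
  refine lt_of_lt_of_le (mul_pos (Finset.prod_pos fun t _ => sub_pos.2 (hp t)) ?_) h
  simp only [tensorInner_action hJs, action_inv_apply hJ, Finset.sum_const, nsmul_eq_mul,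
    Finset.card_univ]
  exact mul_pos hcard (tensorInner_self_pos hf)

end Fock

/-! ### Minimal coset representatives of `Σ(n)` in `Σ(n + 1)` -/

/-- An odd injective map of the points, as an element of the hyperoctahedral group. -/
noncomputable def ofInjective {n : ℕ} (f : Fin n × ℤˣ → Fin n × ℤˣ) (hf : Function.Injective f)
    (hodd : ∀ p, f (opp p) = opp (f p)) : hyperoctahedral n :=
  ⟨Equiv.ofBijective f (Finite.injective_iff_bijective.1 hf), fun i s => hodd (i, s)⟩

theorem ofInjective_apply {n : ℕ} (f : Fin n × ℤˣ → Fin n × ℤˣ)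
    (hf : Function.Injective f) (hodd : ∀ p, f (opp p) = opp (f p)) (p : Fin n × ℤˣ) :
    (ofInjective f hf hodd).1 p = f p := rfl

/-- The inclusion of the points of `Σ(n)` in those of `Σ(n + 1)`. -/
def castPoint {n : ℕ} (p : Fin n × ℤˣ) : Fin (n + 1) × ℤˣ := (p.1.castSucc, p.2)

@[simp] theorem signedVal_castPoint {n : ℕ} (p : Fin n × ℤˣ) :
    signedVal (castPoint p) = signedVal p := rfl

theorem castPoint_injective {n : ℕ} : Function.Injective (castPoint (n := n)) := by
  intro p r h
  apply signedVal_injective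
  rw [← signedVal_castPoint, h, signedVal_castPoint]

theorem castPoint_ne_last {n : ℕ} (p : Fin n × ℤˣ) (s : ℤˣ) : castPoint p ≠ (Fin.last n, s) :=
  fun h => (Fin.castSucc_lt_last p.1).ne (Prod.mk.inj h).1

/-- Every point of `Σ(n + 1)` is a point of `Σ(n)` or `±(n + 1)`. -/
theorem point_cases {n : ℕ} {P : Fin (n + 1) × ℤˣ → Prop} (hcast : ∀ p, P (castPoint p))
    (hlast : ∀ s, P (Fin.last n, s)) (p : Fin (n + 1) × ℤˣ) : P p := by
  obtain ⟨i, s⟩ := p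
  induction i using Fin.lastCases with
  | last => exact hlast s
  | cast i => exact hcast (i, s)

/-- The map of points that agrees with `f` on points of `Σ(n)` and with `g` at `±(n + 1)`. -/
def glue {n : ℕ} {β : Type*} (f : Fin n × ℤˣ → β) (g : ℤˣ → β) (p : Fin (n + 1) × ℤˣ) : β :=
  Fin.lastCases (motive := fun _ => β) (g p.2) (fun i => f (i, p.2)) p.1

@[simp] theorem glue_castPoint {n : ℕ} {β : Type*} (f : Fin n × ℤˣ → β) (g : ℤˣ → β)
    (p : Fin n × ℤˣ) : glue f g (castPoint p) = f p := by
  simp [glue, castPoint]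

@[simp] theorem glue_last {n : ℕ} {β : Type*} (f : Fin n × ℤˣ → β) (g : ℤˣ → β) (s : ℤˣ) :
    glue f g (Fin.last n, s) = g s := by
  simp [glue]

/-- The inclusion of `Σ(n)` in `Σ(n + 1)`. -/
noncomputable def extend {n : ℕ} (u : hyperoctahedral n) : hyperoctahedral (n + 1) :=
  ofInjective (glue (fun p => castPoint (u.1 p)) fun s => (Fin.last n, s))
    (by
      intro p r
      induction p using point_cases with
      | hcast p =>
        induction r using point_cases with
        | hcast r => simp [castPoint_injective.eq_iff]
        | hlast s => simp [castPoint_ne_last]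
      | hlast s =>
        induction r using point_cases with
        | hcast r => simp [(castPoint_ne_last _ _).symm]
        | hlast s => simp)
    (by
      intro p
      induction p using point_cases with
      | hcast p =>
        change glue _ _ (castPoint (opp p)) = _
        rw [glue_castPoint, glue_castPoint, apply_opp]
        rfl
      | hlast s =>
        change glue _ _ (Fin.last n, -s) = _
        rw [glue_last, glue_last]
        rfl)

@[simp] theorem extend_castPoint {n : ℕ} (u : hyperoctahedral n) (p : Fin n × ℤˣ) :
    (extend u).1 (castPoint p) = castPoint (u.1 p) :=
  (ofInjective_apply _ _ _ _).trans (glue_castPoint _ _ _)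

@[simp] theorem extend_last {n : ℕ} (u : hyperoctahedral n) (s : ℤˣ) :
    (extend u).1 (Fin.last n, s) = (Fin.last n, s) :=
  (ofInjective_apply _ _ _ _).trans (glue_last _ _ _)

theorem extend_inv {n : ℕ} (u : hyperoctahedral n) : (extend u)⁻¹ = extend u⁻¹ := by
  rw [inv_eq_iff_mul_eq_one]
  apply Subtype.ext
  ext1 p
  change (extend u).1 ((extend u⁻¹).1 p) = p
  induction p using point_cases with
  | hcast p =>
    rw [extend_castPoint, extend_castPoint]
    exact congrArg castPoint (u.1.apply_symm_apply p)
  | hlast s => simp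

theorem extend_injective {n : ℕ} : Function.Injective (extend (n := n)) := by
  intro u v h
  apply Subtype.ext
  ext1 p
  apply castPoint_injective
  rw [← extend_castPoint, h, extend_castPoint]

theorem exists_extend_eq {n : ℕ} {τ : hyperoctahedral (n + 1)}
    (h : τ.1 (Fin.last n, 1) = (Fin.last n, 1)) : ∃ u, extend u = τ := by
  have hlast : ∀ s, τ.1 (Fin.last n, s) = (Fin.last n, s) := by
    intro s
    rcases Int.units_eq_one_or s with rfl | rfl
    · exact h
    · have := apply_opp τ (Fin.last n, 1)
      rw [h] at this
      exact this
  have hcast : ∀ p, ∃ r, τ.1 (castPoint p) = castPoint r := by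
    intro p
    generalize hr : τ.1 (castPoint p) = r
    induction r using point_cases with
    | hcast r => exact ⟨r, rfl⟩
    | hlast s =>
      rw [← hlast s] at hr
      exact absurd (τ.1.injective hr) (castPoint_ne_last p s)
  choose f hf using hcast
  refine ⟨ofInjective f ?_ ?_, ?_⟩
  · intro p r hpr
    apply castPoint_injective
    apply τ.1.injective
    rw [hf, hf, hpr]
  · intro p
    apply castPoint_injective
    rw [← hf]
    refine (apply_opp τ (castPoint p)).trans ?_
    rw [hf]
    rfl
  · apply Subtype.ext
    ext1 p
    induction p using point_cases with
    | hcast p => exact (extend_castPoint _ _).trans (hf p).symm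
    | hlast s => rw [extend_last, hlast]

/-- The element of `Σ(n + 1)` that sends `n + 1` to `p`, and `1, …, n` increasingly to the
remaining positive points. -/
noncomputable def insertPoint {n : ℕ} (p : Fin (n + 1) × ℤˣ) : hyperoctahedral (n + 1) :=
  ofInjective (glue (fun r => (p.1.succAbove r.1, r.2)) fun s => (p.1, p.2 * s))
    (by
      intro a b
      induction a using point_cases with
      | hcast a =>
        induction b using point_cases with
        | hcast b =>
          simp [castPoint_injective.eq_iff, Prod.ext_iff]
        | hlast s => simp
      | hlast s =>
        induction b using point_cases with
        | hcast b => simp [Fin.ne_succAbove]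
        | hlast s => simp)
    (by
      intro a
      induction a using point_cases with
      | hcast a =>
        change glue _ _ (castPoint (opp a)) = _
        rw [glue_castPoint, glue_castPoint]
        rfl
      | hlast s =>
        change glue _ _ (Fin.last n, -s) = _
        rw [glue_last, glue_last, mul_neg]
        rfl)

@[simp] theorem insertPoint_castPoint {n : ℕ} (p : Fin (n + 1) × ℤˣ) (r : Fin n × ℤˣ) :
    (insertPoint p).1 (castPoint r) = (p.1.succAbove r.1, r.2) :=
  (ofInjective_apply _ _ _ _).trans (glue_castPoint _ _ _)

@[simp] theorem insertPoint_last {n : ℕ} (p : Fin (n + 1) × ℤˣ) (s : ℤˣ) :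
    (insertPoint p).1 (Fin.last n, s) = (p.1, p.2 * s) :=
  (ofInjective_apply _ _ _ _).trans (glue_last _ _ _)

/-- The factorization of `Σ(n + 1)` into `Σ(n)` and minimal coset representatives. -/
theorem extend_mul_bijective (n : ℕ) : Function.Bijective
    fun x : hyperoctahedral n × (Fin (n + 1) × ℤˣ) => extend x.1 * (insertPoint x.2)⁻¹ := by
  -- The point `p` is recovered from the product `σ` as `σ⁻¹(n + 1)`.
  have hval : ∀ (u : hyperoctahedral n) (p : Fin (n + 1) × ℤˣ),
      (extend u * (insertPoint p)⁻¹)⁻¹.1 (Fin.last n, 1) = p := by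
    intro u p
    rw [mul_inv_rev, inv_inv, extend_inv]
    change (insertPoint p).1 ((extend u⁻¹).1 (Fin.last n, 1)) = p
    rw [extend_last, insertPoint_last, mul_one]
  constructor
  · rintro ⟨u, p⟩ ⟨v, r⟩ h
    dsimp only at h
    have hpr : p = r := by rw [← hval u p, h, hval]
    subst hpr
    rw [extend_injective (mul_right_cancel h)]
  · intro σ
    have h : (σ * insertPoint (σ⁻¹.1 (Fin.last n, 1))).1 (Fin.last n, 1) = (Fin.last n, 1) := by
      change σ.1 ((insertPoint (σ⁻¹.1 (Fin.last n, 1))).1 (Fin.last n, 1)) = _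
      rw [insertPoint_last, mul_one]
      exact σ.1.apply_symm_apply _
    obtain ⟨u, hu⟩ := exists_extend_eq h
    refine ⟨(u, σ⁻¹.1 (Fin.last n, 1)), ?_⟩
    dsimp only
    rw [hu, mul_inv_cancel_right]

/-! ### Multiplicativity of the weight -/

/-- A root of `Σ(n)` as a root of `Σ(n + 1)`. -/
def castRoot {n : ℕ} (t : Root n) : Root (n + 1) := ⟨(castPoint t.1.1, castPoint t.1.2), t.2⟩

theorem signedVal_abs_le {n : ℕ} (p : Fin n × ℤˣ) : |signedVal p| ≤ n := by
  rw [abs_le]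
  obtain ⟨i, s⟩ := p
  rcases Int.units_eq_one_or s with rfl | rfl <;> simp <;> omega

/-- The root of `Σ(n + 1)` given by a point of `Σ(n)` and `n + 1`. -/
def lastRoot {n : ℕ} (p : Fin n × ℤˣ) : Root (n + 1) :=
  ⟨(castPoint p, (Fin.last n, 1)), by
    have := abs_le.1 (signedVal_abs_le p)
    simp
    omega⟩

/-- The root of `Σ(n + 1)` given by `±(n + 1)`. -/
def shortLastRoot (n : ℕ) : Root (n + 1) :=
  ⟨((Fin.last n, -1), (Fin.last n, 1)), by simp; omega⟩

theorem root_cases {n : ℕ} (t : Root (n + 1)) :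
    (∃ t', castRoot t' = t) ∨ (∃ p, lastRoot p = t) ∨ shortLastRoot n = t := by
  obtain ⟨⟨a, b⟩, h⟩ := t
  dsimp only at h
  induction b using point_cases with
  | hcast b =>
    have hb := abs_le.1 (signedVal_abs_le b)
    induction a using point_cases with
    | hcast a => exact Or.inl ⟨⟨(a, b), h⟩, rfl⟩
    | hlast s =>
      exfalso
      rcases Int.units_eq_one_or s with rfl | rfl <;> simp at h <;> omega
  | hlast s =>
    have hs : s = 1 := by
      rcases Int.units_eq_one_or s with rfl | rfl
      · rfl
      · exfalso
        have ha := abs_le.1 (signedVal_abs_le a)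
        simp at h ha
        omega
    subst hs
    induction a using point_cases with
    | hcast a => exact Or.inr (Or.inl ⟨a, rfl⟩)
    | hlast s =>
      right
      right
      rcases Int.units_eq_one_or s with rfl | rfl
      · exact absurd h.1 (lt_irrefl _)
      · rfl

theorem prod_root_succ {n : ℕ} (F : Root (n + 1) → ℝ) :
    ∏ t, F t = (∏ t, F (castRoot t)) *
      ((∏ i, F (lastRoot (i, 1)) * F (lastRoot (i, -1))) * F (shortLastRoot n)) := by
  let g : Root n ⊕ ((Fin n × ℤˣ) ⊕ Unit) → Root (n + 1) :=
    Sum.elim castRoot (Sum.elim lastRoot fun _ => shortLastRoot n)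
  have hg : Function.Bijective g := by
    constructor
    · refine Function.Injective.sumElim ?_ (Function.Injective.sumElim ?_ ?_ ?_) ?_
      · intro t t' h
        have h' := Prod.mk.inj (congrArg Subtype.val h)
        exact Subtype.ext (Prod.ext (castPoint_injective h'.1) (castPoint_injective h'.2))
      · intro p p' h
        exact castPoint_injective (Prod.mk.inj (congrArg Subtype.val h)).1
      · intro _ _ _
        rfl
      · intro p _ h
        exact castPoint_ne_last _ _ (Prod.mk.inj (congrArg Subtype.val h)).1
      · rintro t (p | _) h
        · exact castPoint_ne_last _ _ (Prod.mk.inj (congrArg Subtype.val h)).2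
        · exact castPoint_ne_last _ _ (Prod.mk.inj (congrArg Subtype.val h)).2
    · intro t
      rcases root_cases t with ⟨t', h⟩ | ⟨p, h⟩ | h
      · exact ⟨Sum.inl t', h⟩
      · exact ⟨Sum.inr (Sum.inl p), h⟩
      · exact ⟨Sum.inr (Sum.inr ()), h⟩
  rw [← hg.prod_comp, Fintype.prod_sum_type, Fintype.prod_sum_type, Fintype.prod_prod_type]
  simp [g]

-- The identity lies on the positive side of every root, so the roots separating it from `σ` are the
-- inversions of `σ`.
open Classical in
theorem weight_eq_prod (α q : ℝ) {n : ℕ} (σ : hyperoctahedral n) :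
    weight α q σ = ∏ t : Root n, if Below σ t.1.1 t.1.2 then 1 else rootParam α q t := by
  have h := weight_inv_mul α q 1 σ
  rw [inv_one, one_mul] at h
  rw [h]
  refine Finset.prod_congr rfl fun t _ => ?_
  have h1 : Below 1 t.1.1 t.1.2 := by
    have : ∀ p, ((1 : hyperoctahedral n)⁻¹).1 p = p := fun p => by rw [inv_one]; rfl
    simpa only [Below, this] using t.2.1
  by_cases h2 : Below σ t.1.1 t.1.2 <;> simp [Separates, h1, h2]

/-- If no root is inverted by both elements, the separating set is the disjoint union of the two
inversion sets, and the lengths add. -/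
theorem weight_inv_mul_of_below (α q : ℝ) {n : ℕ} {σ τ : hyperoctahedral n}
    (h : ∀ t : Root n, Below σ t.1.1 t.1.2 ∨ Below τ t.1.1 t.1.2) :
    weight α q (σ⁻¹ * τ) = weight α q σ * weight α q τ := by
  classical
  rw [weight_inv_mul, weight_eq_prod, weight_eq_prod, ← Finset.prod_mul_distrib]
  refine Finset.prod_congr rfl fun t _ => ?_
  have := h t
  by_cases h1 : Below σ t.1.1 t.1.2 <;> by_cases h2 : Below τ t.1.1 t.1.2 <;>
    simp [Separates, h1, h2] at this ⊢

theorem below_extend_castRoot {n : ℕ} (u : hyperoctahedral n) (t : Root n) :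
    Below (extend u) (castRoot t).1.1 (castRoot t).1.2 ↔ Below u t.1.1 t.1.2 := by
  simp only [Below, castRoot, extend_inv, extend_castPoint, signedVal_castPoint]

theorem below_extend_last {n : ℕ} (u : hyperoctahedral n) (p : Fin n × ℤˣ) :
    Below (extend u) (lastRoot p).1.1 (lastRoot p).1.2 := by
  have := abs_le.1 (signedVal_abs_le (u⁻¹.1 p))
  simp only [Below, lastRoot, extend_inv, extend_castPoint, extend_last, signedVal_castPoint,
    signedVal_one, Fin.val_last]
  omega

theorem below_extend_shortLast {n : ℕ} (u : hyperoctahedral n) :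
    Below (extend u) (shortLastRoot n).1.1 (shortLastRoot n).1.2 := by
  simp only [Below, shortLastRoot, extend_inv, extend_last, signedVal_neg, signedVal_one,
    Fin.val_last]
  omega

theorem below_insertPoint_inv {n : ℕ} (p a b : Fin (n + 1) × ℤˣ) :
    Below (insertPoint p)⁻¹ a b ↔
      signedVal ((insertPoint p).1 a) < signedVal ((insertPoint p).1 b) := by
  rw [Below, inv_inv]

theorem signedVal_succAbove_lt {n : ℕ} (k : Fin (n + 1)) {a b : Fin n × ℤˣ}
    (h : signedVal a < signedVal b) :
    signedVal (k.succAbove a.1, a.2) < signedVal (k.succAbove b.1, b.2) := by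
  obtain ⟨i, s⟩ := a
  obtain ⟨j, t⟩ := b
  have hij : k.succAbove i < k.succAbove j ↔ i < j := Fin.succAbove_lt_succAbove_iff
  have hji : k.succAbove j < k.succAbove i ↔ j < i := Fin.succAbove_lt_succAbove_iff
  simp only [Fin.lt_def] at hij hji
  rcases Int.units_eq_one_or s with rfl | rfl <;> rcases Int.units_eq_one_or t with rfl | rfl <;>
    simp only [signedVal_neg, signedVal_one] at h ⊢ <;> omega

theorem below_insertPoint_castRoot {n : ℕ} (p : Fin (n + 1) × ℤˣ) (t : Root n) :
    Below (insertPoint p)⁻¹ (castRoot t).1.1 (castRoot t).1.2 := by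
  rw [below_insertPoint_inv]
  simp only [castRoot, insertPoint_castPoint]
  exact signedVal_succAbove_lt _ t.2.1

theorem isShort_castRoot {n : ℕ} (t : Root n) : IsShort (castRoot t) ↔ IsShort t :=
  (Fin.castSucc_injective n).eq_iff

theorem not_isShort_lastRoot {n : ℕ} (p : Fin n × ℤˣ) : ¬ IsShort (lastRoot p) :=
  (Fin.castSucc_lt_last p.1).ne

theorem isShort_shortLastRoot (n : ℕ) : IsShort (shortLastRoot n) := rfl

theorem weight_extend (α q : ℝ) {n : ℕ} (u : hyperoctahedral n) :
    weight α q (extend u) = weight α q u := by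
  classical
  rw [weight_eq_prod, prod_root_succ, weight_eq_prod]
  simp only [below_extend_castRoot, below_extend_last, below_extend_shortLast, if_true, mul_one,
    Finset.prod_const_one, rootParam, isShort_castRoot]

/-- The weight of the minimal coset representative attached to a point. -/
noncomputable def cosetWeight (α q : ℝ) {n : ℕ} (p : Fin (n + 1) × ℤˣ) : ℝ :=
  if p.2 = 1 then q ^ (n - p.1.val) else α * q ^ (n + p.1.val)

theorem prod_range_ite_le (q : ℝ) (n k : ℕ) :
    ∏ i ∈ Finset.range n, (if k ≤ i then q else 1) = q ^ (n - k) := by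
  induction n with
  | zero => simp
  | succ n ih =>
    rw [Finset.prod_range_succ, ih]
    split_ifs with h
    · rw [← pow_succ]
      congr 1
      omega
    · rw [mul_one]
      congr 1
      omega

theorem prod_range_ite_lt (q : ℝ) (n k : ℕ) :
    ∏ i ∈ Finset.range n, (if i < k then q else 1) = q ^ min n k := by
  induction n with
  | zero => simp
  | succ n ih =>
    rw [Finset.prod_range_succ, ih]
    split_ifs with h
    · rw [← pow_succ]
      congr 1
      omega
    · rw [mul_one]
      congr 1
      omega

/-- Only roots involving `n + 1` can be inverted. With `k` the zero-based position of `p`, a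
positive `p` inverts the roots of the `n - k` points `i ≥ k`. A negative `p` inverts those of all
`n` positive points, those of the `k` negative points with `i < k`, and the short root. -/
theorem weight_insertPoint_inv (α q : ℝ) {n : ℕ} (p : Fin (n + 1) × ℤˣ) :
    weight α q (insertPoint p)⁻¹ = cosetWeight α q p := by
  classical
  rw [weight_eq_prod, prod_root_succ]
  simp only [below_insertPoint_castRoot, if_true, Finset.prod_const_one, one_mul]
  simp only [below_insertPoint_inv, rootParam, not_isShort_lastRoot, isShort_shortLastRoot,
    if_true, if_false]
  simp only [lastRoot, shortLastRoot, insertPoint_castPoint, insertPoint_last]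
  obtain ⟨k, s⟩ := p
  have hlt : ∀ i : Fin n, (k.succAbove i).val < k.val ↔ i.val < k.val := by
    intro i
    rw [← Fin.lt_def, Fin.succAbove_lt_iff_castSucc_lt, Fin.lt_def, Fin.val_castSucc]
  have hne : ∀ i : Fin n, (k.succAbove i).val ≠ k.val := fun i h =>
    Fin.succAbove_ne k i (Fin.ext h)
  rcases Int.units_eq_one_or s with rfl | rfl
  · have h1 : ∀ i : Fin n, (if signedVal (k.succAbove i, (1 : ℤˣ)) < signedVal (k, (1 : ℤˣ))
        then 1 else q) = if k.val ≤ i.val then q else 1 := by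
      intro i
      have := hlt i
      simp only [signedVal_one]
      split_ifs <;> first | rfl | (exfalso; omega)
    have h2 : ∀ i : Fin n, signedVal (k.succAbove i, (-1 : ℤˣ)) < signedVal (k, (1 : ℤˣ)) := by
      intro i
      simp only [signedVal_one, signedVal_neg]
      omega
    have h3 : signedVal (k, (-1 : ℤˣ)) < signedVal (k, (1 : ℤˣ)) := by
      simp only [signedVal_one, signedVal_neg]
      omega
    simp only [mul_one, one_mul, h1, h2, h3, if_true, cosetWeight]
    rw [Fin.prod_univ_eq_prod_range (fun i => if k.val ≤ i then q else 1), prod_range_ite_le]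
  · have h1 : ∀ i : Fin n, ¬ signedVal (k.succAbove i, (1 : ℤˣ)) < signedVal (k, (-1 : ℤˣ)) := by
      intro i
      simp only [signedVal_one, signedVal_neg]
      omega
    have h2 : ∀ i : Fin n, (if signedVal (k.succAbove i, (-1 : ℤˣ)) < signedVal (k, (-1 : ℤˣ))
        then 1 else q) = if i.val < k.val then q else 1 := by
      intro i
      have := hlt i
      have := hne i
      simp only [signedVal_one, signedVal_neg]
      split_ifs <;> first | rfl | (exfalso; omega)
    have h3 : ¬ signedVal (k, (1 : ℤˣ)) < signedVal (k, (-1 : ℤˣ)) := by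
      simp only [signedVal_one, signedVal_neg]
      omega
    have h4 : (-1 : ℤˣ) ≠ 1 := by decide
    simp only [mul_one, mul_neg, neg_neg, h1, h2, h3, h4, if_false, cosetWeight]
    rw [Finset.prod_mul_distrib, Finset.prod_const, Finset.card_univ, Fintype.card_fin,
      Fin.prod_univ_eq_prod_range (fun i => if i < k.val then q else 1), prod_range_ite_lt,
      min_eq_right (by omega), mul_comm, pow_add]

/-- Elements of `Σ(n)` invert no root involving `n + 1`, and the coset representatives invert only
such roots. -/
theorem weight_extend_mul (α q : ℝ) {n : ℕ} (u : hyperoctahedral n) (p : Fin (n + 1) × ℤˣ) :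
    weight α q (extend u * (insertPoint p)⁻¹) = weight α q u * cosetWeight α q p := by
  have h : extend u = (extend u⁻¹)⁻¹ := by rw [extend_inv, inv_inv]
  rw [h, weight_inv_mul_of_below, weight_extend, weight_inv, weight_insertPoint_inv]
  intro t
  rcases root_cases t with ⟨t', rfl⟩ | ⟨p, rfl⟩ | rfl
  · exact Or.inr (below_insertPoint_castRoot _ _)
  · exact Or.inl (below_extend_last _ _)
  · exact Or.inl (below_extend_shortLast _)

section Fock

variable {H : Type*} [NormedAddCommGroup H] [InnerProductSpace ℂ H]

/-! ### Creation and annihilation on tensor powers -/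

/-- The creation operator on `H^{⊗n}`. -/
noncomputable def tensorCreation (x : H) (n : ℕ) : (⨂[ℂ]^n H) →ₗ[ℂ] (⨂[ℂ]^(n + 1) H) :=
  PiTensorProduct.lift ((LinearMap.applyₗ x).compMultilinearMap
    (PiTensorProduct.tprod ℂ : MultilinearMap ℂ (fun _ : Fin (n + 1) => H) _).curryRight)

theorem tensorCreation_tprod (x : H) {n : ℕ} (y : Fin n → H) :
    tensorCreation x n (PiTensorProduct.tprod ℂ y) =
      PiTensorProduct.tprod ℂ (Fin.snoc y x : Fin (n + 1) → H) := by
  simp [tensorCreation]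

/-- The adjoint of the creation operator for the free inner product. -/
noncomputable def contractLast (x : H) (n : ℕ) : (⨂[ℂ]^(n + 1) H) →ₗ[ℂ] (⨂[ℂ]^n H) :=
  PiTensorProduct.lift (MultilinearMap.uncurryRight
    ((LinearMap.smulRightₗ (innerₛₗ ℂ x)).compMultilinearMap
      (PiTensorProduct.tprod ℂ : MultilinearMap ℂ (fun _ : Fin n => H) (⨂[ℂ]^n H))))

theorem contractLast_tprod (x : H) {n : ℕ} (y : Fin (n + 1) → H) :
    contractLast x n (PiTensorProduct.tprod ℂ y) =
      inner ℂ x (y (Fin.last n)) • PiTensorProduct.tprod ℂ fun i : Fin n => y i.castSucc := by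
  simp [contractLast]
  rfl

theorem tensorInner_creation_action_extend (J : H →ₗ[ℂ] H) (x : H) {n : ℕ}
    (u : hyperoctahedral n) (f : ⨂[ℂ]^n H) (g : ⨂[ℂ]^(n + 1) H) :
    tensorInner (n + 1) (tensorCreation x n f) (action J (extend u) g) =
      tensorInner n f (action J u (contractLast x n g)) := by
  induction f using tensor_induction with
  | zero => simp
  | add f f' h h' => simp [h, h']
  | smul c f h => simp [h]
  | tprod y =>
    induction g using tensor_induction with
    | zero => simp
    | add f f' h h' => simp only [map_add, h, h']
    | smul c f h => simp only [map_smul, h]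
    | tprod z =>
      rw [tensorCreation_tprod, action_tprod, contractLast_tprod, map_smul, map_smul, action_tprod,
        tensorInner_tprod, tensorInner_tprod, Fin.prod_univ_castSucc, smul_eq_mul, mul_comm]
      congr 1
      · rw [extend_inv, extend_last]
        simp
      · refine Finset.prod_congr rfl fun i _ => ?_
        have : (extend u)⁻¹.1 (i.castSucc, 1) = castPoint (u⁻¹.1 (i, 1)) := by
          rw [extend_inv]
          exact extend_castPoint u⁻¹ (i, 1)
        rw [this]
        simp only [Fin.snoc_castSucc]
        rfl

/-- The annihilation operator on `H^{⊗(n+1)}`: the adjoint of the creation operator for the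
deformed form. -/
noncomputable def tensorAnnihilation (J : H →ₗ[ℂ] H) (α q : ℝ) (x : H) (n : ℕ) :
    (⨂[ℂ]^(n + 1) H) →ₗ[ℂ] (⨂[ℂ]^n H) :=
  contractLast x n ∘ₗ
    ∑ p : Fin (n + 1) × ℤˣ, (cosetWeight α q p : ℂ) • action J (insertPoint p)⁻¹

/-- The factorization `P^{(n+1)} = (P^{(n)} ⊗ 1) R`, where `R` is the weighted sum over coset
representatives. It makes contraction of the last factor after `R` the adjoint of creation. -/
theorem symmetrization_succ {J : H →ₗ[ℂ] H} (hJ : ∀ x, J (J x) = x) (α q : ℝ) {n : ℕ}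
    (g : ⨂[ℂ]^(n + 1) H) :
    symmetrization J α q (n + 1) g = ∑ u : hyperoctahedral n, (weight α q u : ℂ) •
      action J (extend u)
        (∑ p : Fin (n + 1) × ℤˣ, (cosetWeight α q p : ℂ) • action J (insertPoint p)⁻¹ g) := by
  rw [symmetrization_apply, ← (extend_mul_bijective n).sum_comp, Fintype.sum_prod_type]
  refine Finset.sum_congr rfl fun u _ => ?_
  rw [map_sum, Finset.smul_sum]
  refine Finset.sum_congr rfl fun p _ => ?_
  rw [weight_extend_mul, action_mul hJ, map_smul, smul_smul, Complex.ofReal_mul]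

theorem tensorInner_creation_symmetrization {J : H →ₗ[ℂ] H} (hJ : ∀ x, J (J x) = x) (α q : ℝ)
    (x : H) {n : ℕ} (f : ⨂[ℂ]^n H) (g : ⨂[ℂ]^(n + 1) H) :
    tensorInner (n + 1) (tensorCreation x n f) (symmetrization J α q (n + 1) g) =
      tensorInner n f (symmetrization J α q n (tensorAnnihilation J α q x n g)) := by
  rw [symmetrization_succ hJ, symmetrization_apply, map_sum, map_sum]
  refine Finset.sum_congr rfl fun u _ => ?_
  rw [map_smul, map_smul, tensorInner_creation_action_extend]
  simp [tensorAnnihilation]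

theorem action_insertPoint_inv_tprod (J : H →ₗ[ℂ] H) {n : ℕ} (p : Fin (n + 1) × ℤˣ)
    (x : H) (y : Fin (n + 1) → H) :
    contractLast x n (action J (insertPoint p)⁻¹ (PiTensorProduct.tprod ℂ y)) =
      inner ℂ x (signedVec J y p) • PiTensorProduct.tprod ℂ fun i : Fin n =>
        y (p.1.succAbove i) := by
  rw [action_tprod, contractLast_tprod, inv_inv, insertPoint_last, mul_one]
  congr 2
  ext i
  have : (insertPoint p).1 (i.castSucc, 1) = (p.1.succAbove i, 1) :=
    insertPoint_castPoint p (i, 1)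
  rw [this, signedVec_one]

theorem tensorAnnihilation_tprod (J : H →ₗ[ℂ] H) (α q : ℝ) (x : H) {n : ℕ}
    (y : Fin (n + 1) → H) :
    tensorAnnihilation J α q x n (PiTensorProduct.tprod ℂ y) =
      ∑ k : Fin (n + 1), ((q : ℂ) ^ (n - k.val) * inner ℂ x (y k) +
        α * (q : ℂ) ^ (n + k.val) * inner ℂ x (J (y k))) •
          PiTensorProduct.tprod ℂ fun i : Fin n => y (k.succAbove i) := by
  simp only [tensorAnnihilation, LinearMap.comp_apply, LinearMap.sum_apply, LinearMap.smul_apply,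
    map_sum, map_smul, action_insertPoint_inv_tprod, Fintype.sum_prod_type]
  refine Finset.sum_congr rfl fun k _ => ?_
  have h : (Finset.univ : Finset ℤˣ) = {1, -1} := by decide
  have h' : (-1 : ℤˣ) ≠ 1 := by decide
  rw [h, Finset.sum_pair h'.symm]
  simp only [cosetWeight, signedVec_one, signedVec_neg_one, if_true, h', if_false, smul_smul,
    ← add_smul]
  push_cast
  rfl

theorem tensorAnnihilation_creation_zero (J : H →ₗ[ℂ] H) (α q : ℝ) (x y : H) (f : ⨂[ℂ]^0 H) :
    tensorAnnihilation J α q x 0 (tensorCreation y 0 f) =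
      (inner ℂ x y + α * inner ℂ x (J y) : ℂ) • f := by
  induction f using tensor_induction with
  | zero => simp
  | add f f' h h' => simp only [map_add, h, h', smul_add]
  | smul c f h => simp only [map_smul, h, smul_comm c]
  | tprod z =>
    rw [tensorCreation_tprod, tensorAnnihilation_tprod]
    refine (Fin.sum_univ_one _).trans ?_
    have : (fun i : Fin 0 => (Fin.snoc z y : Fin 1 → H) ((0 : Fin 1).succAbove i)) = z :=
      funext fun i => i.elim0
    rw [this]
    simp [Fin.snoc]

/-- The commutation relation `b(x) b*(y) = q b*(y) b(x) + ⟨x, y⟩ + α ⟨x, J y⟩ q^{2N}`. -/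
theorem tensorAnnihilation_creation_succ (J : H →ₗ[ℂ] H) (α q : ℝ) (x y : H) {n : ℕ}
    (f : ⨂[ℂ]^(n + 1) H) :
    tensorAnnihilation J α q x (n + 1) (tensorCreation y (n + 1) f) =
      (inner ℂ x y + α * (q : ℂ) ^ (2 * (n + 1)) * inner ℂ x (J y) : ℂ) • f +
        (q : ℂ) • tensorCreation y n (tensorAnnihilation J α q x n f) := by
  induction f using tensor_induction with
  | zero => simp
  | add f f' h h' =>
    simp only [map_add, h, h', smul_add]
    abel
  | smul c f h => simp only [map_smul, h, smul_comm c, smul_add]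
  | tprod z =>
    rw [tensorCreation_tprod, tensorAnnihilation_tprod, tensorAnnihilation_tprod,
      Fin.sum_univ_castSucc]
    -- The last summand, which pairs `x` with the created `y`, gives the scalar. Every other
    -- exponent grows by one, whence the common factor `q`.
    refine (add_comm _ _).trans ?_
    congr 1
    · simp [two_mul]
    · rw [map_sum, Finset.smul_sum]
      refine Finset.sum_congr rfl fun k _ => ?_
      have hk : n + 1 - k.castSucc.val = n - k.val + 1 := by
        have := k.2
        rw [Fin.val_castSucc]
        omega
      have hs : (fun i : Fin (n + 1) => (Fin.snoc z y : Fin (n + 2) → H) (k.castSucc.succAbove i)) =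
          Fin.snoc (fun i : Fin n => z (k.succAbove i)) y := by
        ext i
        induction i using Fin.lastCases with
        | last => simp
        | cast i => simp
      rw [map_smul, tensorCreation_tprod, smul_smul, hs, hk]
      congr 1
      simp only [Fin.snoc_castSucc, Fin.val_castSucc]
      ring

/-! ### The deformed norm on tensor powers -/

/-- The deformed form on `H^{⊗n}`. -/
noncomputable def tensorForm (J : H →ₗ[ℂ] H) (α q : ℝ) {n : ℕ} (f g : ⨂[ℂ]^n H) : ℂ :=
  tensorInner n f (symmetrization J α q n g)

variable {J : H →ₗ[ℂ] H} {α q : ℝ}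

theorem inner_involution_re (hJs : J.IsSymmetric) (x : H) :
    inner ℂ x (J x) = ((inner ℂ x (J x) : ℂ).re : ℂ) := by
  refine (Complex.conj_eq_iff_re.1 ?_).symm
  rw [inner_conj_symm]
  exact hJs x x

theorem abs_inner_involution_le (hJs : J.IsSymmetric) (hJ : ∀ x, J (J x) = x) (x : H) :
    |(inner ℂ x (J x) : ℂ).re| ≤ ‖x‖ ^ 2 := by
  have hn : ‖J x‖ = ‖x‖ := by
    have h : (inner ℂ (J x) (J x) : ℂ) = inner ℂ x x := by rw [hJs, hJ]
    rw [inner_self_eq_norm_sq_to_K, inner_self_eq_norm_sq_to_K] at h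
    have h' : ‖J x‖ ^ 2 = ‖x‖ ^ 2 := by exact_mod_cast h
    exact (sq_eq_sq₀ (norm_nonneg _) (norm_nonneg _)).1 h'
  calc |(inner ℂ x (J x) : ℂ).re| ≤ ‖(inner ℂ x (J x) : ℂ)‖ := Complex.abs_re_le_norm _
    _ ≤ ‖x‖ * ‖J x‖ := norm_inner_le_norm _ _
    _ = ‖x‖ ^ 2 := by rw [hn, sq]

theorem tensorForm_conj (hJs : J.IsSymmetric) {n : ℕ} (f g : ⨂[ℂ]^n H) :
    conj (tensorForm J α q f g) = tensorForm J α q g f :=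
  tensorInner_symmetrization_conj hJs α q f g

theorem tensorForm_nonneg (hJs : J.IsSymmetric) (hJ : ∀ x, J (J x) = x) (hα : |α| < 1)
    (hq : |q| < 1) {n : ℕ} (f : ⨂[ℂ]^n H) : 0 ≤ (tensorForm J α q f f).re := by
  rcases eq_or_ne f 0 with rfl | hf
  · simp [tensorForm]
  · exact (symmetrization_pos hJs hJ hα hq hf).le

theorem tensorForm_creation (hJ : ∀ x, J (J x) = x) (x : H) {n : ℕ} (f : ⨂[ℂ]^n H)
    (g : ⨂[ℂ]^(n + 1) H) : tensorForm J α q (tensorCreation x n f) g =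
      tensorForm J α q f (tensorAnnihilation J α q x n g) :=
  tensorInner_creation_symmetrization hJ α q x f g

theorem tensorForm_creation_self_zero (hJs : J.IsSymmetric) (hJ : ∀ x, J (J x) = x) (x : H)
    (f : ⨂[ℂ]^0 H) :
    (tensorForm J α q (tensorCreation x 0 f) (tensorCreation x 0 f)).re =
      (‖x‖ ^ 2 + α * (inner ℂ x (J x) : ℂ).re) * (tensorForm J α q f f).re := by
  have h := inner_involution_re hJs x
  generalize (inner ℂ x (J x) : ℂ).re = β at *
  have e : (inner ℂ x x + α * inner ℂ x (J x) : ℂ) = ((‖x‖ ^ 2 + α * β : ℝ) : ℂ) := by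
    rw [h, inner_self_eq_norm_sq_to_K]
    push_cast
    rfl
  rw [tensorForm_creation hJ, tensorAnnihilation_creation_zero, e, tensorForm, map_smul, map_smul,
    smul_eq_mul, Complex.re_ofReal_mul, tensorForm]

/-- Pair the commutation relation for `y = x` with `f`; adjointness turns `q b*(x) b(x)` into `q
‖b(x) f‖²`. -/
theorem tensorForm_creation_self_succ (hJs : J.IsSymmetric) (hJ : ∀ x, J (J x) = x) (x : H)
    {n : ℕ} (f : ⨂[ℂ]^(n + 1) H) :
    (tensorForm J α q (tensorCreation x (n + 1) f) (tensorCreation x (n + 1) f)).re =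
      (‖x‖ ^ 2 + α * q ^ (2 * (n + 1)) * (inner ℂ x (J x) : ℂ).re) * (tensorForm J α q f f).re +
        q * (tensorForm J α q (tensorAnnihilation J α q x n f)
          (tensorAnnihilation J α q x n f)).re := by
  have h := inner_involution_re hJs x
  generalize (inner ℂ x (J x) : ℂ).re = β at *
  have e : (inner ℂ x x + α * (q : ℂ) ^ (2 * (n + 1)) * inner ℂ x (J x) : ℂ) =
      ((‖x‖ ^ 2 + α * q ^ (2 * (n + 1)) * β : ℝ) : ℂ) := by
    rw [h, inner_self_eq_norm_sq_to_K]
    push_cast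
    rfl
  have hadj : (tensorForm J α q f (tensorCreation x n (tensorAnnihilation J α q x n f))).re =
      (tensorForm J α q (tensorAnnihilation J α q x n f) (tensorAnnihilation J α q x n f)).re := by
    rw [← tensorForm_conj hJs, Complex.conj_re, tensorForm_creation hJ]
  rw [tensorForm_creation hJ, tensorAnnihilation_creation_succ, e, ← hadj]
  simp only [tensorForm, map_add, map_smul, smul_eq_mul, Complex.add_re, Complex.re_ofReal_mul]

end Fock

section Fock

variable {H : Type*} [NormedAddCommGroup H] [InnerProductSpace ℂ H]

/-! ### Bounds for the creation operator on tensor powers -/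

variable {J : H →ₗ[ℂ] H} {α q : ℝ}

/-- An operator and its adjoint share their bounds, by expanding `0 ≤ ‖C g - b* b g‖²` and using
`‖b* b g‖² ≤ C ‖b g‖²`. No completeness is needed. -/
theorem tensorForm_annihilation_le (hJs : J.IsSymmetric) (hJ : ∀ x, J (J x) = x) (hα : |α| < 1)
    (hq : |q| < 1) (x : H) {n : ℕ} {C : ℝ} (hC : 0 < C)
    (h : ∀ f : ⨂[ℂ]^n H, (tensorForm J α q (tensorCreation x n f) (tensorCreation x n f)).re ≤
      C * (tensorForm J α q f f).re) (g : ⨂[ℂ]^(n + 1) H) :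
    (tensorForm J α q (tensorAnnihilation J α q x n g) (tensorAnnihilation J α q x n g)).re ≤
      C * (tensorForm J α q g g).re := by
  set b := tensorAnnihilation J α q x n g with hb
  have h1 : tensorForm J α q (tensorCreation x n b) g = tensorForm J α q b b := by
    rw [tensorForm_creation hJ, hb]
  have h2 : (tensorForm J α q g (tensorCreation x n b)).re = (tensorForm J α q b b).re := by
    rw [← tensorForm_conj hJs, Complex.conj_re, h1]
  have h3 := tensorForm_nonneg hJs hJ hα hq ((C : ℂ) • g - tensorCreation x n b)
  have h4 : (tensorForm J α q ((C : ℂ) • g - tensorCreation x n b)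
      ((C : ℂ) • g - tensorCreation x n b)).re = C * (C * (tensorForm J α q g g).re) -
        C * (tensorForm J α q g (tensorCreation x n b)).re -
        (C * (tensorForm J α q (tensorCreation x n b) g).re -
          (tensorForm J α q (tensorCreation x n b) (tensorCreation x n b)).re) := by
    simp only [tensorForm, map_sub, map_smulₛₗ, LinearMap.sub_apply, LinearMap.smul_apply,
      smul_eq_mul, Complex.conj_ofReal, RingHom.id_apply, Complex.sub_re, Complex.re_ofReal_mul]
    ring
  rw [h4, h2, h1] at h3
  have h5 := h b
  have h6 : 0 ≤ C * (C * (tensorForm J α q g g).re - (tensorForm J α q b b).re) := by linarith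
  linarith [nonneg_of_mul_nonneg_right h6 hC]

theorem tensorForm_creation_le_of_nonpos (hJs : J.IsSymmetric) (hJ : ∀ x, J (J x) = x)
    (hα : |α| < 1) (hq : |q| < 1) (hq0 : q ≤ 0) (x : H) {n : ℕ} (f : ⨂[ℂ]^n H) :
    (tensorForm J α q (tensorCreation x n f) (tensorCreation x n f)).re ≤
      (‖x‖ ^ 2 + max (α * (inner ℂ x (J x) : ℂ).re) 0) * (tensorForm J α q f f).re := by
  have hf := tensorForm_nonneg hJs hJ hα hq f
  cases n with
  | zero =>
    rw [tensorForm_creation_self_zero hJs hJ]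
    gcongr
    exact le_max_left _ _
  | succ n =>
    rw [tensorForm_creation_self_succ hJs hJ]
    have h1 := mul_nonpos_of_nonpos_of_nonneg hq0
      (tensorForm_nonneg hJs hJ hα hq (tensorAnnihilation J α q x n f))
    -- The exponent is even, so this power of the nonpositive `q` still lies in `[0, 1]`.
    have h2 : α * q ^ (2 * (n + 1)) * (inner ℂ x (J x) : ℂ).re ≤
        max (α * (inner ℂ x (J x) : ℂ).re) 0 := by
      have h3 : 0 ≤ q ^ (2 * (n + 1)) := (even_two_mul _).pow_nonneg q
      have h4 : q ^ (2 * (n + 1)) ≤ 1 := by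
        rw [← (even_two_mul (n + 1)).pow_abs]
        exact pow_le_one₀ (abs_nonneg _) hq.le
      calc α * q ^ (2 * (n + 1)) * (inner ℂ x (J x) : ℂ).re
          = q ^ (2 * (n + 1)) * (α * (inner ℂ x (J x) : ℂ).re) := by ring
        _ ≤ q ^ (2 * (n + 1)) * max (α * (inner ℂ x (J x) : ℂ).re) 0 := by
            gcongr
            exact le_max_left _ _
        _ ≤ 1 * max (α * (inner ℂ x (J x) : ℂ).re) 0 := by
            gcongr
        _ = _ := one_mul _
    have h5 := mul_le_mul_of_nonneg_right (add_le_add_right h2 (‖x‖ ^ 2)) hf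
    linarith

theorem tensorForm_creation_le_of_nonneg (hJs : J.IsSymmetric) (hJ : ∀ x, J (J x) = x)
    (hα : |α| < 1) (hq : |q| < 1) (hq0 : 0 ≤ q) {x : H} (hx : x ≠ 0) {n : ℕ} (f : ⨂[ℂ]^n H) :
    (tensorForm J α q (tensorCreation x n f) (tensorCreation x n f)).re ≤
      ‖x‖ ^ 2 * ((1 - q ^ (n + 1)) * (1 + |α| * q ^ n) / (1 - q)) * (tensorForm J α q f f).re := by
  have hx2 : 0 < ‖x‖ ^ 2 := by positivity
  have hq1 : 0 < 1 - q := sub_pos.2 ((le_abs_self q).trans_lt hq)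
  have hβ : α * (inner ℂ x (J x) : ℂ).re ≤ |α| * ‖x‖ ^ 2 :=
    calc α * (inner ℂ x (J x) : ℂ).re ≤ |α * (inner ℂ x (J x) : ℂ).re| := le_abs_self _
      _ ≤ |α| * ‖x‖ ^ 2 := by
        rw [abs_mul]
        gcongr
        exact abs_inner_involution_le hJs hJ x
  induction n with
  | zero =>
    rw [tensorForm_creation_self_zero hJs hJ]
    refine mul_le_mul_of_nonneg_right ?_ (tensorForm_nonneg hJs hJ hα hq f)
    have : (1 - q ^ (0 + 1)) * (1 + |α| * q ^ 0) / (1 - q) = 1 + |α| := by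
      field_simp
      ring
    rw [this]
    linarith
  | succ n ih =>
    have hC : 0 < ‖x‖ ^ 2 * ((1 - q ^ (n + 1)) * (1 + |α| * q ^ n) / (1 - q)) := by
      have : q ^ (n + 1) < 1 := pow_lt_one₀ hq0 (by linarith) (by omega)
      have : 0 < 1 - q ^ (n + 1) := by linarith
      positivity
    have h1 := tensorForm_annihilation_le hJs hJ hα hq x hC ih f
    rw [tensorForm_creation_self_succ hJs hJ]
    have h2 : ‖x‖ ^ 2 + α * q ^ (2 * (n + 1)) * (inner ℂ x (J x) : ℂ).re ≤
        ‖x‖ ^ 2 + q ^ (2 * (n + 1)) * (|α| * ‖x‖ ^ 2) := by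
      have : 0 ≤ q ^ (2 * (n + 1)) := by positivity
      nlinarith [mul_le_mul_of_nonneg_left hβ this]
    calc _ ≤ (‖x‖ ^ 2 + q ^ (2 * (n + 1)) * (|α| * ‖x‖ ^ 2)) * (tensorForm J α q f f).re +
          q * (‖x‖ ^ 2 * ((1 - q ^ (n + 1)) * (1 + |α| * q ^ n) / (1 - q)) *
            (tensorForm J α q f f).re) :=
          add_le_add (mul_le_mul_of_nonneg_right h2 (tensorForm_nonneg hJs hJ hα hq f))
            (mul_le_mul_of_nonneg_left h1 hq0)
      -- The constants `C_n` of the statement solve `C_{n+1} = ‖x‖² (1 + |α| q^{2(n+1)}) + q C_n`.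
      _ = _ := by
        field_simp
        ring

/-! ### Test vectors for the lower bounds -/

/-- The tensor power `x ⊗ ⋯ ⊗ x`. -/
noncomputable def tensorPow (x : H) (n : ℕ) : ⨂[ℂ]^n H := PiTensorProduct.tprod ℂ fun _ => x

theorem tensorCreation_tensorPow (x : H) (n : ℕ) :
    tensorCreation x n (tensorPow x n) = tensorPow x (n + 1) := by
  rw [tensorPow, tensorCreation_tprod, tensorPow]
  congr 1
  ext i
  induction i using Fin.lastCases with
  | last => simp
  | cast i => simp

theorem tensorPow_ne_zero {x : H} (hx : x ≠ 0) (n : ℕ) : tensorPow x n ≠ 0 := by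
  intro h
  have : tensorInner n (tensorPow x n) (tensorPow x n) = 0 := by rw [h, map_zero]
  rw [tensorPow, tensorInner_tprod, Finset.prod_const, Finset.card_univ, Fintype.card_fin] at this
  exact hx (inner_self_eq_zero.1 (by_contra fun h0 => pow_ne_zero n h0 this))

/-- The ratio `‖x^{⊗(n+1)}‖² / ‖x^{⊗n}‖²`. -/
theorem tensorForm_tensorPow_succ (hJs : J.IsSymmetric) (hJ : ∀ x, J (J x) = x) (hq : |q| < 1)
    (x : H) (n : ℕ) :
    (tensorForm J α q (tensorPow x (n + 1)) (tensorPow x (n + 1))).re =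
      (1 - q ^ (n + 1)) / (1 - q) * (‖x‖ ^ 2 + α * (inner ℂ x (J x) : ℂ).re * q ^ n) *
        (tensorForm J α q (tensorPow x n) (tensorPow x n)).re := by
  have h := inner_involution_re hJs x
  generalize (inner ℂ x (J x) : ℂ).re = β at *
  have hq1 : 1 - q ≠ 0 := (sub_pos.2 ((le_abs_self q).trans_lt hq)).ne'
  -- Deleting any factor leaves `x^{⊗n}`. The coefficients form two geometric sums, of `q^{n-k}` and
  -- of `q^{n+k}`, the second being `q^n` times the first.
  have hb : tensorAnnihilation J α q x n (tensorPow x (n + 1)) =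
      (((1 - q ^ (n + 1)) / (1 - q) * (‖x‖ ^ 2 + α * β * q ^ n) : ℝ) : ℂ) • tensorPow x n := by
    rw [tensorPow, tensorAnnihilation_tprod, ← Finset.sum_smul, h, inner_self_eq_norm_sq_to_K]
    congr 1
    have hg : ∑ k ∈ Finset.range (n + 1), q ^ k = (1 - q ^ (n + 1)) / (1 - q) := by
      rw [geom_sum_eq (by intro h1; exact hq1 (by linarith)), ← neg_div_neg_eq]
      ring
    have hg' : ∑ k ∈ Finset.range (n + 1), q ^ (n - k) = (1 - q ^ (n + 1)) / (1 - q) := by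
      rw [← hg, ← Finset.sum_range_reflect (fun k => q ^ k)]
      simp only [Nat.add_sub_cancel]
    have e : ∑ k ∈ Finset.range (n + 1), (q ^ (n - k) * ‖x‖ ^ 2 + α * q ^ (n + k) * β) =
        (1 - q ^ (n + 1)) / (1 - q) * (‖x‖ ^ 2 + α * β * q ^ n) := by
      rw [Finset.sum_add_distrib, ← Finset.sum_mul, ← Finset.sum_mul, ← Finset.mul_sum, hg']
      simp only [pow_add]
      rw [← Finset.mul_sum, ← pow_add, hg]
      ring
    rw [← e, ← Fin.sum_univ_eq_sum_range (fun k => q ^ (n - k) * ‖x‖ ^ 2 + α * q ^ (n + k) * β)]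
    push_cast
    rfl
  conv_lhs => rw [← tensorCreation_tensorPow, tensorForm_creation hJ, tensorCreation_tensorPow, hb]
  rw [tensorForm, map_smul, map_smul, smul_eq_mul, Complex.re_ofReal_mul, tensorForm]

/-! ### The deformed norm on the Fock space -/

theorem deformedInner_eq_sum (f g : FockSpace H) {s : Finset ℕ} (hs : ∀ n, f n ≠ 0 → n ∈ s) :
    deformedInner J α q f g = ∑ n ∈ s, tensorForm J α q (f n) (g n) := by
  classical
  have e : ∀ n, fockSymmetrization J α q g n = symmetrization J α q n (g n) := fun n => rfl
  unfold deformedInner freeInner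
  rw [DFinsupp.sum]
  refine (Finset.sum_subset (s₂ := s) ?_ ?_).trans ?_
  · intro n hn
    exact hs n (by simpa using hn)
  · intro n _ hn
    have : f n = 0 := by simpa using hn
    rw [this, map_zero, LinearMap.zero_apply]
  · exact Finset.sum_congr rfl fun n _ => by rw [e, tensorForm]

theorem deformedInner_conj (hJs : J.IsSymmetric) (f g : FockSpace H) :
    conj (deformedInner J α q f g) = deformedInner J α q g f := by
  classical
  rw [deformedInner_eq_sum f g (s := f.support ∪ g.support) (by simp +contextual),
    deformedInner_eq_sum g f (s := f.support ∪ g.support) (by simp +contextual), map_sum]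
  exact Finset.sum_congr rfl fun n _ => tensorForm_conj hJs _ _

theorem exists_deformedInner_self_eq (f : FockSpace H) :
    ∃ s : Finset ℕ, (∀ n, f n ≠ 0 → n ∈ s) ∧
      (deformedInner J α q f f).re = ∑ n ∈ s, (tensorForm J α q (f n) (f n)).re := by
  classical
  refine ⟨f.support, by simp, ?_⟩
  rw [deformedInner_eq_sum f f (s := f.support) (by simp), Complex.re_sum]

theorem deformedInner_self_pos (hJs : J.IsSymmetric) (hJ : ∀ x, J (J x) = x) (hα : |α| < 1)
    (hq : |q| < 1) {f : FockSpace H} (hf : f ≠ 0) : 0 < (deformedInner J α q f f).re := by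
  obtain ⟨s, hs, h⟩ := exists_deformedInner_self_eq (J := J) (α := α) (q := q) f
  obtain ⟨n, hn⟩ : ∃ n, f n ≠ 0 := by
    by_contra! hcon
    exact hf (DFinsupp.ext hcon)
  rw [h]
  exact Finset.sum_pos' (fun n _ => tensorForm_nonneg hJs hJ hα hq _)
    ⟨n, hs n hn, symmetrization_pos hJs hJ hα hq hn⟩

theorem creation_apply_zero (x : H) (f : FockSpace H) : creation x f 0 = 0 := by
  induction f using DirectSum.induction_on with
  | zero => simp
  | add f g hf hg => rw [map_add, DirectSum.add_apply, hf, hg, add_zero]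
  | of n u =>
    rw [← DirectSum.lof_eq_of ℂ, creation, DirectSum.toModule_lof]
    exact DFinsupp.single_eq_of_ne (by omega)

theorem creation_of (x : H) (n : ℕ) (u : ⨂[ℂ]^n H) :
    creation x (DirectSum.lof ℂ ℕ (fun m => ⨂[ℂ]^m H) n u) =
      DirectSum.lof ℂ ℕ (fun m => ⨂[ℂ]^m H) (n + 1) (tensorCreation x n u) := by
  rw [creation, DirectSum.toModule_lof]
  rfl

theorem creation_apply_succ (x : H) (f : FockSpace H) (n : ℕ) :
    creation x f (n + 1) = tensorCreation x n (f n) := by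
  induction f using DirectSum.induction_on with
  | zero => simp
  | add f g hf hg => rw [map_add, DirectSum.add_apply, hf, hg, DirectSum.add_apply, map_add]
  | of m u =>
    rw [← DirectSum.lof_eq_of ℂ, creation_of]
    by_cases h : m = n
    · subst h
      rw [DirectSum.lof_apply, DirectSum.lof_apply]
    · have h1 : DirectSum.lof ℂ ℕ (fun m => ⨂[ℂ]^m H) m u n = 0 :=
        DFinsupp.single_eq_of_ne (by omega)
      rw [h1, map_zero]
      exact DFinsupp.single_eq_of_ne (by omega)

theorem fockNorm_lof (n : ℕ) (u : ⨂[ℂ]^n H) :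
    fockNorm J α q (DirectSum.lof ℂ ℕ (fun m => ⨂[ℂ]^m H) n u) =
      √(tensorForm J α q u u).re := by
  rw [fockNorm, deformedInner_eq_sum _ _ (s := {n}), Finset.sum_singleton, DirectSum.lof_apply]
  intro m hm
  by_contra h
  exact hm (DFinsupp.single_eq_of_ne (by simpa using h))

/-- Distinct degrees are orthogonal and creation shifts the degree by one, so a uniform bound in
each degree suffices. -/
theorem fockNorm_creation_le (x : H) {C : ℝ} (hC : 0 ≤ C)
    (h : ∀ (n : ℕ) (f : ⨂[ℂ]^n H),
      (tensorForm J α q (tensorCreation x n f) (tensorCreation x n f)).re ≤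
        C * (tensorForm J α q f f).re) (f : FockSpace H) :
    fockNorm J α q (creation x f) ≤ √C * fockNorm J α q f := by
  obtain ⟨s, hs, e⟩ := exists_deformedInner_self_eq (J := J) (α := α) (q := q) f
  rw [fockNorm, fockNorm, ← Real.sqrt_mul hC, e]
  apply Real.sqrt_le_sqrt
  rw [deformedInner_eq_sum _ _ (s := s.map ⟨Nat.succ, Nat.succ_injective⟩), Finset.sum_map,
    Complex.re_sum, Finset.mul_sum]
  · refine Finset.sum_le_sum fun n _ => ?_
    simp only [Function.Embedding.coeFn_mk, Nat.succ_eq_add_one, creation_apply_succ]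
    exact h n (f n)
  · intro m hm
    cases m with
    | zero => exact absurd (creation_apply_zero x f) hm
    | succ m =>
      rw [creation_apply_succ] at hm
      have : f m ≠ 0 := fun h0 => hm (by rw [h0, map_zero])
      simpa using hs m this

/-! ### The operator norm of the creation operator -/

theorem opNorm_creation_le {x : H} {C : ℝ}
    (h : ∀ f, fockNorm J α q (creation x f) ≤ √C * fockNorm J α q f) :
    opNorm J α q (creation x) ≤ √C :=
  csInf_le ⟨0, fun _ hc => hc.1⟩ ⟨Real.sqrt_nonneg C, h⟩

/-- The squared operator norm dominates the ratios `‖x^{⊗(n+1)}‖² / ‖x^{⊗n}‖²`. -/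
theorem le_opNorm_creation_sq (hJs : J.IsSymmetric) (hJ : ∀ x, J (J x) = x) (hα : |α| < 1)
    (hq : |q| < 1) {x : H} (hx : x ≠ 0) {C : ℝ}
    (h : ∀ f, fockNorm J α q (creation x f) ≤ √C * fockNorm J α q f) (n : ℕ) :
    (1 - q ^ (n + 1)) / (1 - q) * (‖x‖ ^ 2 + α * (inner ℂ x (J x) : ℂ).re * q ^ n) ≤
      opNorm J α q (creation x) ^ 2 := by
  -- Boundedness keeps the set of admissible constants nonempty; the infimum of the empty set would
  -- be `0`.
  refine (Real.sqrt_le_left ?_).1 (le_csInf ⟨√C, Real.sqrt_nonneg C, h⟩ ?_)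
  · exact Real.sInf_nonneg fun _ hc => hc.1
  · rintro c ⟨hc, hcf⟩
    have h1 := hcf (DirectSum.lof ℂ ℕ (fun m => ⨂[ℂ]^m H) n (tensorPow x n))
    have hp : 0 < (tensorForm J α q (tensorPow x n) (tensorPow x n)).re :=
      symmetrization_pos hJs hJ hα hq (tensorPow_ne_zero hx n)
    rw [creation_of, tensorCreation_tensorPow, fockNorm_lof, fockNorm_lof,
      tensorForm_tensorPow_succ hJs hJ hq, Real.sqrt_mul' _ hp.le] at h1
    exact le_of_mul_le_mul_right h1 (Real.sqrt_pos.2 hp)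

theorem opNorm_nonneg (T : FockSpace H →ₗ[ℂ] FockSpace H) : 0 ≤ opNorm J α q T :=
  Real.sInf_nonneg fun _ hc => hc.1

theorem norm_div_sqrt_le_opNorm_creation (hJs : J.IsSymmetric) (hJ : ∀ x, J (J x) = x)
    (hα : |α| < 1) (hq : |q| < 1) {x : H} (hx : x ≠ 0) {C : ℝ}
    (h : ∀ f, fockNorm J α q (creation x f) ≤ √C * fockNorm J α q f) :
    ‖x‖ / √(1 - q) ≤ opNorm J α q (creation x) := by
  have hq1 : 0 < 1 - q := sub_pos.2 ((le_abs_self q).trans_lt hq)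
  have hlim := tendsto_pow_atTop_nhds_zero_of_abs_lt_one hq
  have hlim' := (Filter.tendsto_add_atTop_iff_nat 1).2 hlim
  have ht : Filter.Tendsto (fun n : ℕ => (1 - q ^ (n + 1)) / (1 - q) *
      (‖x‖ ^ 2 + α * (inner ℂ x (J x) : ℂ).re * q ^ n)) Filter.atTop
      (nhds ((1 - 0) / (1 - q) * (‖x‖ ^ 2 + α * (inner ℂ x (J x) : ℂ).re * 0))) :=
    ((hlim'.const_sub 1).div_const _).mul ((hlim.const_mul _).const_add _)
  have hle := le_of_tendsto' ht (le_opNorm_creation_sq hJs hJ hα hq hx h)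
  refine (sq_le_sq₀ (by positivity) (opNorm_nonneg _)).1 ?_
  rw [div_pow, Real.sq_sqrt hq1.le]
  refine le_trans (le_of_eq ?_) hle
  ring

theorem norm_div_sqrt_lt_opNorm_creation (hJs : J.IsSymmetric) (hJ : ∀ x, J (J x) = x)
    (hα : |α| < 1) (hq : |q| < 1) {x : H} (hx : x ≠ 0) {C : ℝ}
    (h : ∀ f, fockNorm J α q (creation x f) ≤ √C * fockNorm J α q f) (hq0 : 0 < q)
    (hlt : q < α * (inner ℂ x (J x) : ℂ).re / ‖x‖ ^ 2) :
    ‖x‖ / √(1 - q) < opNorm J α q (creation x) := by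
  have hq1 : 0 < 1 - q := sub_pos.2 ((le_abs_self q).trans_lt hq)
  have hx2 : 0 < ‖x‖ ^ 2 := by positivity
  have hle := le_opNorm_creation_sq hJs hJ hα hq hx h
  generalize α * (inner ℂ x (J x) : ℂ).re = β at *
  rw [lt_div_iff₀ hx2] at hlt
  have hβ : 0 < β := (mul_pos hq0 hx2).trans hlt
  -- Here `β` is `α ⟨x, J x⟩`. The ratio exceeds its limit as soon as `q^{n+1} β < β - q ‖x‖²`,
  -- whose right side is positive by `hlt`; `n` is chosen with even `q^n β` below it.
  obtain ⟨n, hn⟩ := exists_pow_lt_of_lt_one (div_pos (sub_pos.2 hlt) hβ)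
    ((le_abs_self q).trans_lt hq)
  rw [lt_div_iff₀ hβ] at hn
  refine (sq_lt_sq₀ (by positivity) (opNorm_nonneg _)).1 ((?_ : _ < _).trans_le (hle n))
  rw [div_pow, Real.sq_sqrt hq1.le, div_mul_eq_mul_div]
  refine div_lt_div_of_pos_right ?_ hq1
  have hqn : 0 < q ^ n := pow_pos hq0 n
  have h1 : q ^ (n + 1) * β ≤ q ^ n * β := by
    rw [pow_succ]
    nlinarith [mul_pos hqn hβ]
  have h2 : 0 < q ^ n * (β - q * ‖x‖ ^ 2 - q ^ (n + 1) * β) := mul_pos hqn (by linarith)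
  have e : (1 - q ^ (n + 1)) * (‖x‖ ^ 2 + β * q ^ n) =
      ‖x‖ ^ 2 + q ^ n * (β - q * ‖x‖ ^ 2 - q ^ (n + 1) * β) := by ring
  linarith

theorem fockNorm_creation_le_of_nonpos (hJs : J.IsSymmetric) (hJ : ∀ x, J (J x) = x)
    (hα : |α| < 1) (hq : |q| < 1) (hq0 : q ≤ 0) (x : H) (f : FockSpace H) :
    fockNorm J α q (creation x f) ≤
      √(‖x‖ ^ 2 + max (α * (inner ℂ x (J x) : ℂ).re) 0) * fockNorm J α q f :=
  fockNorm_creation_le x (by positivity)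
    (fun _ => tensorForm_creation_le_of_nonpos hJs hJ hα hq hq0 x) f

theorem fockNorm_creation_le_of_nonneg (hJs : J.IsSymmetric) (hJ : ∀ x, J (J x) = x)
    (hα : |α| < 1) (hq : |q| < 1) (hq0 : 0 ≤ q) {x : H} (hx : x ≠ 0) (f : FockSpace H) :
    fockNorm J α q (creation x f) ≤ √((1 + |α|) / (1 - q) * ‖x‖ ^ 2) * fockNorm J α q f := by
  have hq1 : 0 < 1 - q := sub_pos.2 ((le_abs_self q).trans_lt hq)
  refine fockNorm_creation_le x (by positivity) (fun n f => ?_) f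
  refine (tensorForm_creation_le_of_nonneg hJs hJ hα hq hq0 hx f).trans ?_
  refine mul_le_mul_of_nonneg_right ?_ (tensorForm_nonneg hJs hJ hα hq f)
  rw [mul_comm]
  refine mul_le_mul_of_nonneg_right (div_le_div_of_nonneg_right ?_ hq1.le) (by positivity)
  have h1 : 0 ≤ q ^ (n + 1) := by positivity
  have h2 : 0 ≤ q ^ n := by positivity
  have h3 : q ^ n ≤ 1 := pow_le_one₀ hq0 (by linarith)
  have h4 := mul_nonneg (abs_nonneg α) h2
  have h5 := mul_le_mul_of_nonneg_left h3 (abs_nonneg α)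
  have h6 := mul_nonneg h1 (by linarith : 0 ≤ 1 + |α| * q ^ n)
  linarith

/-- From `|α| q^n ≤ q^{n+1}` follows `(1 - q^{n+1}) (1 + |α| q^n) ≤ 1`, so the constants in all
degrees stay below their limit. -/
theorem fockNorm_creation_le_of_abs_le (hJs : J.IsSymmetric) (hJ : ∀ x, J (J x) = x)
    (hα : |α| < 1) (hq : |q| < 1) (hαq : |α| ≤ q) {x : H} (hx : x ≠ 0) (f : FockSpace H) :
    fockNorm J α q (creation x f) ≤ √(‖x‖ ^ 2 / (1 - q)) * fockNorm J α q f := by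
  have hq1 : 0 < 1 - q := sub_pos.2 ((le_abs_self q).trans_lt hq)
  have hq0 : 0 ≤ q := (abs_nonneg α).trans hαq
  refine fockNorm_creation_le x (by positivity) (fun n f => ?_) f
  refine (tensorForm_creation_le_of_nonneg hJs hJ hα hq hq0 hx f).trans ?_
  refine mul_le_mul_of_nonneg_right ?_ (tensorForm_nonneg hJs hJ hα hq f)
  rw [← mul_div_assoc]
  refine div_le_div_of_nonneg_right ?_ hq1.le
  refine mul_le_of_le_one_right (by positivity) ?_
  have h2 : 0 ≤ q ^ n := by positivity
  have h1 : |α| * q ^ n ≤ q ^ (n + 1) := by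
    rw [pow_succ']
    gcongr
  have h3 : 0 ≤ q ^ (n + 1) * (|α| * q ^ n) := by positivity
  linarith

end Fock

end TypeB

/-! ### The inner product and the five norm estimates -/

theorem mainTheorem5 {H : Type*} [NormedAddCommGroup H] [InnerProductSpace ℂ H] [CompleteSpace H]
    (J : H →ₗ[ℂ] H) (hJ_selfAdjoint : J.IsSymmetric) (hJ_involution : ∀ x, J (J x) = x)
    (α q : ℝ) (hα : |α| < 1) (hq : |q| < 1) (x : H) (hx : x ≠ 0) :
    -- `⟨·, ·⟩_{α,q}` is an inner product, for which `b*(x)` is bounded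
    ((∀ f g : TypeB.FockSpace H,
        starRingEnd ℂ (TypeB.deformedInner J α q f g) = TypeB.deformedInner J α q g f) ∧
      (∀ f : TypeB.FockSpace H, f ≠ 0 → 0 < (TypeB.deformedInner J α q f f).re)) ∧
    TypeB.IsBoundedOp J α q (TypeB.creation x) ∧
    (q ≤ 0 → 0 ≤ α * (inner ℂ x (J x)).re →
      TypeB.opNorm J α q (TypeB.creation x) = √(‖x‖ ^ 2 + α * (inner ℂ x (J x)).re)) ∧
    (q ≤ 0 → α * (inner ℂ x (J x)).re < 0 →
      ‖x‖ / √(1 - q) ≤ TypeB.opNorm J α q (TypeB.creation x) ∧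
      TypeB.opNorm J α q (TypeB.creation x) ≤ ‖x‖) ∧
    (|α| ≤ q → TypeB.opNorm J α q (TypeB.creation x) = ‖x‖ / √(1 - q)) ∧
    (0 < q → q < α * (inner ℂ x (J x)).re / ‖x‖ ^ 2 →
      ‖x‖ / √(1 - q) < TypeB.opNorm J α q (TypeB.creation x) ∧
      TypeB.opNorm J α q (TypeB.creation x) ≤ √((1 + |α|) / (1 - q)) * ‖x‖) ∧
    (¬ (q ≤ 0 ∧ 0 ≤ α * (inner ℂ x (J x)).re) →
      ¬ (q ≤ 0 ∧ α * (inner ℂ x (J x)).re < 0) →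
      ¬ (|α| ≤ q) →
      ¬ (0 < q ∧ q < α * (inner ℂ x (J x)).re / ‖x‖ ^ 2) →
      ‖x‖ / √(1 - q) ≤ TypeB.opNorm J α q (TypeB.creation x) ∧
      TypeB.opNorm J α q (TypeB.creation x) ≤ √((1 + |α|) / (1 - q)) * ‖x‖) := by
  have hq1 : 0 < 1 - q := sub_pos.2 ((le_abs_self q).trans_lt hq)
  have hnn : 0 ≤ q → ∀ f, TypeB.fockNorm J α q (TypeB.creation x f) ≤
      √((1 + |α|) / (1 - q) * ‖x‖ ^ 2) * TypeB.fockNorm J α q f := fun h =>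
    TypeB.fockNorm_creation_le_of_nonneg hJ_selfAdjoint hJ_involution hα hq h hx
  have hnp : q ≤ 0 → ∀ f, TypeB.fockNorm J α q (TypeB.creation x f) ≤
      √(‖x‖ ^ 2 + max (α * (inner ℂ x (J x)).re) 0) * TypeB.fockNorm J α q f := fun h =>
    TypeB.fockNorm_creation_le_of_nonpos hJ_selfAdjoint hJ_involution hα hq h x
  have hsqrt : √((1 + |α|) / (1 - q) * ‖x‖ ^ 2) = √((1 + |α|) / (1 - q)) * ‖x‖ := by
    rw [Real.sqrt_mul (by positivity), Real.sqrt_sq (norm_nonneg x)]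
  refine ⟨⟨TypeB.deformedInner_conj hJ_selfAdjoint, fun f =>
    TypeB.deformedInner_self_pos hJ_selfAdjoint hJ_involution hα hq⟩, ?_, ?_, ?_, ?_, ?_, ?_⟩
  · rcases le_total q 0 with h | h
    · exact ⟨_, hnp h⟩
    · exact ⟨_, hnn h⟩
  · intro h hβ
    have hb := hnp h
    rw [max_eq_left hβ] at hb
    refine le_antisymm (TypeB.opNorm_creation_le hb) ?_
    -- The upper bound is already attained at the vacuum, the test vector of degree `0`.
    have h0 := TypeB.le_opNorm_creation_sq hJ_selfAdjoint hJ_involution hα hq hx hb 0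
    rw [zero_add, pow_one, div_self hq1.ne', one_mul, pow_zero, mul_one] at h0
    exact Real.sqrt_le_iff.2 ⟨TypeB.opNorm_nonneg _, h0⟩
  · intro h hβ
    have hb := hnp h
    refine ⟨TypeB.norm_div_sqrt_le_opNorm_creation hJ_selfAdjoint hJ_involution hα hq hx hb, ?_⟩
    refine (TypeB.opNorm_creation_le hb).trans (le_of_eq ?_)
    rw [max_eq_right hβ.le, add_zero, Real.sqrt_sq (norm_nonneg x)]
  · intro h
    have hb := TypeB.fockNorm_creation_le_of_abs_le hJ_selfAdjoint hJ_involution hα hq h hx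
    refine le_antisymm ((TypeB.opNorm_creation_le hb).trans (le_of_eq ?_))
      (TypeB.norm_div_sqrt_le_opNorm_creation hJ_selfAdjoint hJ_involution hα hq hx hb)
    rw [Real.sqrt_div (by positivity), Real.sqrt_sq (norm_nonneg x)]
  · intro h hlt
    refine ⟨TypeB.norm_div_sqrt_lt_opNorm_creation hJ_selfAdjoint hJ_involution hα hq hx
      (hnn h.le) h hlt, ?_⟩
    exact (TypeB.opNorm_creation_le (hnn h.le)).trans (le_of_eq hsqrt)
  · intro h1 h2 _ _
    -- The first two cases exhaust `q ≤ 0`, so their exclusion leaves nonnegative `q`.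
    have h : 0 ≤ q := by
      by_contra! hneg
      rcases le_or_gt 0 (α * (inner ℂ x (J x)).re) with h | h
      · exact h1 ⟨hneg.le, h⟩
      · exact h2 ⟨hneg.le, h⟩
    refine ⟨TypeB.norm_div_sqrt_le_opNorm_creation hJ_selfAdjoint hJ_involution hα hq hx
      (hnn h), ?_⟩
    exact (TypeB.opNorm_creation_le (hnn h)).trans (le_of_eq hsqrt)
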